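/- An oracle is a length-preserving function $\alpha:\{0,1\}^*\to\{0,1\}^*$, and $\alpha_n$ is its restriction to $\{0,1\}^n$. It is strictly 1-Lipschitz if, for all strings $X,X'$ of equal length at Hamming distance $1$, the strings $\alpha(X),\alpha(X')$ are at Hamming distance exactly $1$. We consider relations $R(X,\alpha)$ between a binary string $X$ and an oracle $\alpha$. For a class $K$ of oracles, a family $(C_n)_{n\ge 0}$ of oracle circuits computes $R$ on $K$ if for all $n$, all $X\in\{0,1\}^n$ and all $\alpha\in K$, the circuit $C_n$ with oracle $\alpha_n$ accepts $X$ if and only if $R(X,\alpha)$ holds. A comparator oracle circuit for inputs of length $n$ has wires, each annotated at its left end by a constant, an input bit or a negated input bit, one designated output wire, and a sequence of gates: comparator gates (which put the minimum of the values of two wires on the first one and the maximum on the second one), $\neg$-gates, and $\alpha_n$-gates, which take the values of $n$ distinct wires as input and put their $n$ outputs, in any order, on these same $n$ wires. Its size is the number of wires plus the number of gates. For $k\ge 1$, an $\mathsf{NC}^k(\alpha)$ circuit family is a family of polynomial-size Boolean circuits with constants, $\neg$-gates, $\wedge$- and $\vee$-gates of fan-in two, and $\alpha_n$-gates (where $n$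 is the length of the input), with unbounded fan-out, of depth $O(\log^k n)$ (an oracle gate counts as one gate), in which at most $O(\log^{k-1}n)$ oracle gates lie on any path. An $\mathsf{NC}(\alpha)$ circuit family is an $\mathsf{NC}^k(\alpha)$ circuit family for some $k\ge1$. A circuit family is uniform if it is $\mathsf{AC}^0$-uniform: describing $C_n$ by the list of its annotations and gates and its output, each item being a list of numbers (its type, and the inputs, wires or values it refers to), the relation "entry $j$ of item $i$ in the description of $C_n$ is $x$" between the numbers $n,i,j,x$ (in unary) is in uniform $\mathsf{AC}^0$, i.e. is definable by a first-order formula over $+,\cdot,=,\le,\mathrm{BIT}$ with all quantifiers bounded by polynomials. **Theorem.** (i) There is a relation $R_1(X,\alpha)$ that is computed, on all oracles, by some uniform polynomial-size family of comparator oracle circuits, but that is not computed by any $\mathsf{NC}(\alpha)$ circuit family, uniform or not, even if the family is only required to compute $R_1$ on the strictly 1-Lipschitz oracles. (ii) There is a relation $R_2(X,\alpha)$ that is computed, on all oracles, by some uniform $\mathsf{NC}^3(\alpha)$ circuit family, but that is not computed by any polynomial-size family of comparator oracle circuits, uniform or not, even if the family is only required to compute $R_2$ on the strictly 1-Lipschitz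 oracles. -/

import Mathlib

namespace OracleSeparation

/-! ### Oracles and relations -/

/-- A length-preserving oracle `α : {0,1}* → {0,1}*`, given by its restrictions
`α n : {0,1}ⁿ → {0,1}ⁿ`. -/
abbrev Oracle : Type := (n : ℕ) → (Fin n → Bool) → (Fin n → Bool)

/-- A relation `R(X, α)` between a binary string `X` (of length `n`) and an oracle `α`. -/
abbrev OracleRelation : Type := (n : ℕ) → (Fin n → Bool) → Oracle → Prop

/-- `α` is strictly 1-Lipschitz: strings of equal length at Hamming distance 1 are mapped to
strings at Hamming distance exactly 1. -/
def StrictlyLipschitz (α : Oracle) : Prop :=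
  ∀ (n : ℕ) (X X' : Fin n → Bool), hammingDist X X' = 1 → hammingDist (α n X) (α n X') = 1

/-! ### Uniformity -/

/-- Relations on natural numbers definable by first-order formulas over `+`, `·`, `=`, `≤` and
`BIT`, in which every quantifier is bounded by a polynomial in the remaining variables. For number
arguments presented in unary these are exactly the relations in uniform `AC⁰`. -/
inductive AC0Definable : {k : ℕ} → ((Fin k → ℕ) → Prop) → Prop
  | eq {k : ℕ} (p q : MvPolynomial (Fin k) ℕ) :
      AC0Definable fun v => MvPolynomial.eval v p = MvPolynomial.eval v q
  | le {k : ℕ} (p q : MvPolynomial (Fin k) ℕ) :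
      AC0Definable fun v => MvPolynomial.eval v p ≤ MvPolynomial.eval v q
  | bit {k : ℕ} (p q : MvPolynomial (Fin k) ℕ) :
      AC0Definable fun v => (MvPolynomial.eval v p).testBit (MvPolynomial.eval v q) = true
  | not {k : ℕ} {R : (Fin k → ℕ) → Prop} :
      AC0Definable R → AC0Definable fun v => ¬ R v
  | and {k : ℕ} {R S : (Fin k → ℕ) → Prop} :
      AC0Definable R → AC0Definable S → AC0Definable fun v => R v ∧ S v
  | exBounded {k : ℕ} (p : MvPolynomial (Fin k) ℕ) {R : (Fin (k + 1) → ℕ) → Prop} :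
      AC0Definable R → AC0Definable fun v => ∃ x ≤ MvPolynomial.eval v p, R (Fin.cons x v)

/-- A family of tables of numbers (the `n`-th table is a list of rows) is `AC⁰`-uniform if the
relation "the `n`-th table has entry `x` in position `j` of row `i`" is in `AC⁰`, where the
arguments are `n, i, j, x` in this order. -/
def AC0Uniform (table : ℕ → List (List ℕ)) : Prop :=
  AC0Definable (k := 4) fun v =>
    ∃ row : List ℕ, (table (v 0))[v 1]? = some row ∧ row[v 2]? = some (v 3)

/-- A function on natural numbers bounded by a polynomial. -/
def PolyBounded (s : ℕ → ℕ) : Prop :=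
  ∃ p : Polynomial ℕ, ∀ n, s n ≤ p.eval n

/-! ### Comparator oracle circuits -/

/-- The annotation of the left end of a wire: a constant, an input bit, or a negated input bit. -/
inductive Annotation (n : ℕ) : Type
  | const (b : Bool)
  | pos (i : Fin n)
  | neg (i : Fin n)

namespace Annotation

def eval {n : ℕ} (X : Fin n → Bool) : Annotation n → Bool
  | const b => b
  | pos i => X i
  | neg i => !(X i)

def row {n : ℕ} : Annotation n → List ℕ
  | const b => [0, b.toNat]
  | pos i => [1, i]
  | neg i => [2, i]

end Annotation

/-- Gates on `m` wires. An oracle gate takes its `n` inputs from the distinct wires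
`src 0, …, src (n-1)` and puts its `j`-th output on the wire `src (σ j)`, so that the `n` wires it
consumes are the `n` wires it produces and nothing is duplicated. -/
inductive CGate (n m : ℕ) : Type
  | comparator (i j : Fin m)
  | negation (i : Fin m)
  | oracle (src : Fin n ↪ Fin m) (σ : Equiv.Perm (Fin n))

namespace CGate

/-- The values of the wires after the gate, when `f` is the oracle on strings of length `n` and
`s` gives the values before the gate. A comparator `(i, j)` puts the minimum on wire `i` and the
maximum on wire `j`; it does nothing if `i = j`. -/
noncomputable def apply {n m : ℕ} (f : (Fin n → Bool) → (Fin n → Bool)) (s : Fin m → Bool) :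
    CGate n m → (Fin m → Bool)
  | comparator i j => Function.update (Function.update s i (s i && s j)) j (s i || s j)
  | negation i => Function.update s i (!(s i))
  | oracle src σ => Function.extend (fun j => src (σ j)) (f fun j => s (src j)) s

def row {n m : ℕ} : CGate n m → List ℕ
  | comparator i j => [3, i, j]
  | negation i => [4, i]
  | oracle src σ =>
      5 :: (List.ofFn fun j => (src j : ℕ)) ++ List.ofFn fun j => (src (σ j) : ℕ)

end CGate

/-- An annotated comparator circuit with negation gates and gates for an oracle on `n` bits, for
inputs of length `n`. -/
structure ComparatorCircuit (n : ℕ) : Type where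
  wires : ℕ
  annotation : Fin wires → Annotation n
  gates : List (CGate n wires)
  output : Fin wires

namespace ComparatorCircuit

noncomputable def eval {n : ℕ} (C : ComparatorCircuit n) (f : (Fin n → Bool) → (Fin n → Bool))
    (X : Fin n → Bool) : Bool :=
  C.gates.foldl (fun s g => g.apply f s) (fun w => (C.annotation w).eval X) C.output

def size {n : ℕ} (C : ComparatorCircuit n) : ℕ := C.wires + C.gates.length

/-- The description of a circuit: annotations, then gates, then the output wire. -/
def table {n : ℕ} (C : ComparatorCircuit n) : List (List ℕ) :=
  (List.ofFn fun w => (C.annotation w).row) ++ C.gates.map CGate.row ++ [[6, (C.output : ℕ)]]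

end ComparatorCircuit

/-- The family `C` computes the relation `R`, for all inputs and all oracles in the class `K`. -/
def ComparatorComputes (K : Set Oracle) (C : (n : ℕ) → ComparatorCircuit n)
    (R : OracleRelation) : Prop :=
  ∀ (n : ℕ) (X : Fin n → Bool), ∀ α ∈ K, ((C n).eval (α n) X = true ↔ R n X α)

/-- Nonuniform `CC(α)`, for oracles `α` in the class `K`. -/
def InCC (K : Set Oracle) (R : OracleRelation) : Prop :=
  ∃ C : (n : ℕ) → ComparatorCircuit n,
    PolyBounded (fun n => (C n).size) ∧ ComparatorComputes K C R

/-- Uniform `CC(α)`, for oracles `α` in the class `K`. -/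
def InUniformCC (K : Set Oracle) (R : OracleRelation) : Prop :=
  ∃ C : (n : ℕ) → ComparatorCircuit n,
    PolyBounded (fun n => (C n).size) ∧ AC0Uniform (fun n => (C n).table) ∧
      ComparatorComputes K C R

/-! ### Boolean oracle circuits -/

/-- `Gates n w` is a sequence of gates on inputs of length `n`, each reading values available
before it; `w` is the number of values available at the end, starting with the `n` input bits.
Values have unbounded fan-out. A Boolean gate yields one value, an oracle gate `n` values. -/
inductive Gates (n : ℕ) : ℕ → Type
  | inputs : Gates n n
  | const {w : ℕ} (C : Gates n w) (b : Bool) : Gates n (w + 1)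
  | not {w : ℕ} (C : Gates n w) (i : Fin w) : Gates n (w + 1)
  | and {w : ℕ} (C : Gates n w) (i j : Fin w) : Gates n (w + 1)
  | or {w : ℕ} (C : Gates n w) (i j : Fin w) : Gates n (w + 1)
  | oracle {w : ℕ} (C : Gates n w) (src : Fin n → Fin w) : Gates n (w + n)

namespace Gates

/-- The values computed, when `f` is the oracle on strings of length `n`. -/
def eval {n : ℕ} (f : (Fin n → Bool) → (Fin n → Bool)) (X : Fin n → Bool) :
    {w : ℕ} → Gates n w → (Fin w → Bool)
  | _, inputs => X
  | _, const C b => Fin.snoc (α := fun _ => Bool) (C.eval f X) b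
  | _, not C i => Fin.snoc (α := fun _ => Bool) (C.eval f X) (!(C.eval f X i))
  | _, and C i j => Fin.snoc (α := fun _ => Bool) (C.eval f X) (C.eval f X i && C.eval f X j)
  | _, or C i j => Fin.snoc (α := fun _ => Bool) (C.eval f X) (C.eval f X i || C.eval f X j)
  | _, oracle C src => Fin.append (C.eval f X) (f fun j => C.eval f X (src j))

/-- The depth of each value: the maximal number of gates on a path from an input or a constant to
it (an oracle gate counts as one gate). -/
def depth {n : ℕ} : {w : ℕ} → Gates n w → (Fin w → ℕ)
  | _, inputs => fun _ => 0
  | _, const C _ => Fin.snoc (α := fun _ => ℕ) C.depth 0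
  | _, not C i => Fin.snoc (α := fun _ => ℕ) C.depth (C.depth i + 1)
  | _, and C i j => Fin.snoc (α := fun _ => ℕ) C.depth (max (C.depth i) (C.depth j) + 1)
  | _, or C i j => Fin.snoc (α := fun _ => ℕ) C.depth (max (C.depth i) (C.depth j) + 1)
  | _, oracle C src =>
      Fin.append C.depth fun _ => (Finset.univ.sup fun j => C.depth (src j)) + 1

/-- The oracle nesting depth of each value: the maximal number of oracle gates on a path from an
input or a constant to it. -/
def oracleDepth {n : ℕ} : {w : ℕ} → Gates n w → (Fin w → ℕ)
  | _, inputs => fun _ => 0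
  | _, const C _ => Fin.snoc (α := fun _ => ℕ) C.oracleDepth 0
  | _, not C i => Fin.snoc (α := fun _ => ℕ) C.oracleDepth (C.oracleDepth i)
  | _, and C i j =>
      Fin.snoc (α := fun _ => ℕ) C.oracleDepth (max (C.oracleDepth i) (C.oracleDepth j))
  | _, or C i j =>
      Fin.snoc (α := fun _ => ℕ) C.oracleDepth (max (C.oracleDepth i) (C.oracleDepth j))
  | _, oracle C src =>
      Fin.append C.oracleDepth fun _ => (Finset.univ.sup fun j => C.oracleDepth (src j)) + 1

/-- The description of each gate, in order. -/
def rows {n : ℕ} : {w : ℕ} → Gates n w → List (List ℕ)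
  | _, inputs => []
  | _, const C b => C.rows ++ [[0, b.toNat]]
  | _, not C i => C.rows ++ [[1, (i : ℕ)]]
  | _, and C i j => C.rows ++ [[2, (i : ℕ), (j : ℕ)]]
  | _, or C i j => C.rows ++ [[3, (i : ℕ), (j : ℕ)]]
  | _, oracle C src => C.rows ++ [4 :: List.ofFn fun j => (src j : ℕ)]

end Gates

/-- A Boolean circuit of fan-in at most two with gates for an oracle on `n` bits, for inputs of
length `n`. -/
structure BooleanCircuit (n : ℕ) : Type where
  values : ℕ
  gates : Gates n values
  output : Fin values

namespace BooleanCircuit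

def eval {n : ℕ} (C : BooleanCircuit n) (f : (Fin n → Bool) → (Fin n → Bool))
    (X : Fin n → Bool) : Bool :=
  C.gates.eval f X C.output

/-- The number of gates. -/
def size {n : ℕ} (C : BooleanCircuit n) : ℕ := C.gates.rows.length

def depth {n : ℕ} (C : BooleanCircuit n) : ℕ := Finset.univ.sup C.gates.depth

def oracleDepth {n : ℕ} (C : BooleanCircuit n) : ℕ := Finset.univ.sup C.gates.oracleDepth

/-- The description of a circuit: gates, then the output. -/
def table {n : ℕ} (C : BooleanCircuit n) : List (List ℕ) :=
  C.gates.rows ++ [[5, (C.output : ℕ)]]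

end BooleanCircuit

/-- `s n = O(logᵏ n)`. -/
def PolylogBounded (k : ℕ) (s : ℕ → ℕ) : Prop :=
  ∃ c : ℕ, ∀ n, s n ≤ c * (Nat.log 2 n) ^ k + c

/-- The family `C` computes the relation `R`, for all inputs and all oracles in the class `K`. -/
def BooleanComputes (K : Set Oracle) (C : (n : ℕ) → BooleanCircuit n)
    (R : OracleRelation) : Prop :=
  ∀ (n : ℕ) (X : Fin n → Bool), ∀ α ∈ K, ((C n).eval (α n) X = true ↔ R n X α)

/-- The resource bounds of `NCᵏ(α)`, for `k ≥ 1`: polynomial size, depth `O(logᵏ n)`, oracle gates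
nested at most `O(logᵏ⁻¹ n)` deep. -/
def NCBounds (k : ℕ) (C : (n : ℕ) → BooleanCircuit n) : Prop :=
  PolyBounded (fun n => (C n).size) ∧ PolylogBounded k (fun n => (C n).depth) ∧
    PolylogBounded (k - 1) (fun n => (C n).oracleDepth)

/-- Nonuniform `NC(α)`, the union of the classes `NCᵏ(α)` for `k ≥ 1`, for oracles `α` in the
class `K`. -/
def InNC (K : Set Oracle) (R : OracleRelation) : Prop :=
  ∃ k : ℕ, 1 ≤ k ∧ ∃ C : (n : ℕ) → BooleanCircuit n, NCBounds k C ∧ BooleanComputes K C R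

/-- Uniform `NCᵏ(α)`, for `k ≥ 1` and oracles `α` in the class `K`. -/
def InUniformNC (k : ℕ) (K : Set Oracle) (R : OracleRelation) : Prop :=
  ∃ C : (n : ℕ) → BooleanCircuit n,
    NCBounds k C ∧ AC0Uniform (fun n => (C n).table) ∧ BooleanComputes K C R

end OracleSeparation

/-!
Both relations ask for the first bit of a string that is obtained from the input by applying the
oracle `T` times; before each application the string may be stretched, that is, every bit is
repeated `b` times and the end is cut off (`stretchIter`, `iterRelation`).

* For the first relation nothing is stretched (`b = 1`) and `T` is about `n ^ (1/4)`. Comparator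
  circuits iterate the oracle on the same wires, but a Boolean circuit needs oracle depth `T`.
* For the second relation `b = 29` and `T = (log n) ^ 2`. A Boolean circuit stretches by fan-out,
  but in a comparator circuit copies can only be obtained by repeating computations, and this
  doubles the number of oracle gates at every level.

Both lower bounds use one family of oracles. Fix strings `v 0, …, v T` and let `c i` be `v i`
stretched. The oracle `F j` sends `c i` to `v (i + 1)` for `i < j`. As the distance from `c i`
grows, its value retreats from `v (i + 1)` to the zero string one bit at a time, and outside the
resulting disjoint bumps it is the zero string or a fixed neighbour of it, according to parity. Such
a map is strictly 1-Lipschitz (`Separated.bumpMap_strict`). The strings `v i` are graphs of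
polynomials of bounded degree over a prime field. Two of them are far apart, so a string is close to
at most one of them, and there are more of them than queries: `v i` can be chosen far from
everything that the given circuit asks when it is run with `F 0, …, F (i - 1)`
(`exists_foolingChain`). Only `F T`, not `F (T - 1)`, leads to a first bit that is one.

A value of oracle depth `j` in a Boolean circuit is the same under all of `F j, …, F T`
(`Gates.eval_eq_of_oracleDepth_le`), so a circuit of oracle depth less than `T` fails.

For comparator circuits, compare the runs with `F T` and with `F s`, and follow the Hamming distance
of the states. Comparators and negations do not increase it, and neither does an oracle gate, unless
its query in the first run enters the bump around `c s`; then the distance grows by at most twice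
the bound `W` on the weight of oracle values. A query near `c (s + 1)` in the first run is far from
the query of the same gate in the second run, while the answers are close to each other, so this
gate reduces the distance by `4 * W`. Hence at least twice as many queries are near `c s` as near
`c (s + 1)`, and there are at least `2 ^ (T - 1)` gates
(`ComparatorCircuit.two_pow_le_of_foolingChain`).
-/

namespace OracleSeparation

/-! ### Hamming geometry of the cube -/

section Hamming

variable {ι : Type*} [Fintype ι]

theorem hammingDist_eq_sum (x y : ι → Bool) :
    hammingDist x y = ∑ i, (if x i ≠ y i then 1 else 0) := by
  rw [hammingDist, Finset.card_filter]

/-- The hypercube is bipartite: closed walks have even length. -/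
theorem even_hammingDist_triangle (x y z : ι → Bool) :
    Even (hammingDist x y + hammingDist y z + hammingDist x z) := by
  rw [hammingDist_eq_sum, hammingDist_eq_sum, hammingDist_eq_sum, ← Finset.sum_add_distrib,
    ← Finset.sum_add_distrib]
  refine Finset.even_sum _ fun i _ => ?_
  cases x i <;> cases y i <;> cases z i <;> decide

/-- One step of a geodesic from `x` to `y`. -/
theorem exists_hammingDist_step [DecidableEq ι] {x y : ι → Bool} {d : ℕ}
    (h : hammingDist x y = d + 1) :
    ∃ x', hammingDist x x' = 1 ∧ hammingDist x' y = d := by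
  have hne : x ≠ y := by
    rintro rfl
    simp at h
  obtain ⟨i, hi⟩ := Function.ne_iff.1 hne
  refine ⟨Function.update x i (y i), ?_, ?_⟩
  · rw [hammingDist, Finset.card_eq_one]
    refine ⟨i, ?_⟩
    ext j
    by_cases hj : j = i
    · subst hj; simpa using hi
    · simp [hj]
  · have : ({j | x j ≠ y j} : Finset ι) =
      insert i ({j | Function.update x i (y i) j ≠ y j} : Finset ι) := by
      ext j
      by_cases hj : j = i
      · subst hj; simpa using hi
      · simp [hj]
    rw [hammingDist, this, Finset.card_insert_of_notMem (by simp)] at h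
    simpa [hammingDist] using h

theorem exists_geodesic [DecidableEq ι] (x y : ι → Bool) :
    ∃ u : ℕ → ι → Bool, u 0 = x ∧ u (hammingDist x y) = y ∧
      ∀ k < hammingDist x y, hammingDist (u k) (u (k + 1)) = 1 := by
  induction h : hammingDist x y generalizing x with
  | zero => exact ⟨fun _ => x, rfl, hammingDist_eq_zero.1 h, by simp⟩
  | succ d ih =>
    obtain ⟨x', h1, h2⟩ := exists_hammingDist_step h
    obtain ⟨u, hu0, hud, hu⟩ := ih x' h2
    refine ⟨fun k => k.casesOn x u, rfl, hud, ?_⟩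
    rintro (_ | k) hk
    · simpa [hu0] using h1
    · exact hu k (by omega)

/-- A map of the cube that preserves adjacency is 1-Lipschitz. -/
theorem hammingDist_map_le [DecidableEq ι] {f : (ι → Bool) → (ι → Bool)}
    (hf : ∀ x y, hammingDist x y = 1 → hammingDist (f x) (f y) = 1) (x y : ι → Bool) :
    hammingDist (f x) (f y) ≤ hammingDist x y := by
  induction h : hammingDist x y generalizing x with
  | zero => rw [hammingDist_eq_zero.1 h]; simp
  | succ d ih =>
    obtain ⟨x', h1, h2⟩ := exists_hammingDist_step h
    have := hammingDist_triangle (f x) (f x') (f y)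
    have := hf _ _ h1
    have := ih x' h2
    omega

end Hamming

/-! ### Oracles made of disjoint bumps -/

section Bump

variable {n : ℕ}

/-- The all-zero string. -/
def zeroString (n : ℕ) : Fin n → Bool := fun _ => false

/-- A walk in the cube that starts with the edge from the zero string to `e` and then follows a
geodesic from `e` to `v`. -/
noncomputable def walkTo (e v : Fin n → Bool) : ℕ → Fin n → Bool
  | 0 => zeroString n
  | k + 1 => (exists_geodesic e v).choose k

@[simp] theorem walkTo_zero (e v : Fin n → Bool) : walkTo e v 0 = zeroString n := rfl

@[simp] theorem walkTo_one (e v : Fin n → Bool) : walkTo e v 1 = e :=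
  (exists_geodesic e v).choose_spec.1

theorem walkTo_end (e v : Fin n → Bool) : walkTo e v (hammingDist e v + 1) = v :=
  (exists_geodesic e v).choose_spec.2.1

theorem hammingDist_walkTo_succ {e : Fin n → Bool} (he : hammingDist e (zeroString n) = 1)
    (v : Fin n → Bool) {k : ℕ} (hk : k < hammingDist e v + 1) :
    hammingDist (walkTo e v k) (walkTo e v (k + 1)) = 1 := by
  rcases k with _ | k
  · simpa [hammingDist_comm] using he
  · exact (exists_geodesic e v).choose_spec.2.2 k (by omega)

theorem hammingDist_walkTo_le {e : Fin n → Bool} (he : hammingDist e (zeroString n) = 1)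
    (v : Fin n → Bool) {k : ℕ} (hk : k ≤ hammingDist e v + 1) :
    hammingDist (walkTo e v k) (zeroString n) ≤ k := by
  induction k with
  | zero => simp
  | succ k ih =>
    have h1 := hammingDist_walkTo_succ he v (k := k) (by omega)
    have h2 := ih (by omega)
    have := hammingDist_triangle (walkTo e v (k + 1)) (walkTo e v k) (zeroString n)
    rw [hammingDist_comm (walkTo e v (k + 1)) (walkTo e v k)] at this
    omega

/-- The radius of the bump that carries the value `v` at its centre: the length of `walkTo e v`. -/
def bumpRadius (e v : Fin n → Bool) : ℕ := hammingDist e v + 1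

/-- `y` lies in the bump with centre `c` and value `v`. The two outermost spheres of the ball are
left out, because there the bump agrees with the default value. -/
def InBump (e c v y : Fin n → Bool) : Prop := hammingDist y c + 2 ≤ bumpRadius e v

/-- The value outside all bumps: the zero string or its neighbour `e`, according to parity. -/
def parityDefault (e y : Fin n → Bool) : Fin n → Bool :=
  if Even (hammingDist y (zeroString n)) then zeroString n else e

open Classical in
/-- The map that takes the value `v i` at the centre `c i` for `i < J`, retreats along
`walkTo e (v i)` as the distance from `c i` grows, and takes the default value elsewhere. -/
noncomputable def bumpMap (e : Fin n → Bool) (J : ℕ) (c v : ℕ → Fin n → Bool)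
    (y : Fin n → Bool) : Fin n → Bool :=
  if h : ∃ i < J, InBump e (c i) (v i) y then
    walkTo e (v h.choose) (bumpRadius e (v h.choose) - hammingDist y (c h.choose))
  else parityDefault e y

/-- The bumps with indices below `J` have disjoint balls, and their radii have the parity that
makes their boundary values agree with the default. -/
structure Separated (e : Fin n → Bool) (J : ℕ) (c v : ℕ → Fin n → Bool) : Prop where
  weight_one : hammingDist e (zeroString n) = 1
  disjoint : ∀ i < J, ∀ j < J, i ≠ j →
    bumpRadius e (v i) + bumpRadius e (v j) ≤ hammingDist (c i) (c j)
  parity : ∀ i < J, Even (bumpRadius e (v i) + hammingDist (c i) (zeroString n))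

theorem Separated.mono {e : Fin n → Bool} {J J' : ℕ} {c v : ℕ → Fin n → Bool}
    (h : Separated e J c v) (hJ : J' ≤ J) : Separated e J' c v :=
  ⟨h.weight_one, fun i hi j hj => h.disjoint i (by omega) j (by omega),
    fun i hi => h.parity i (by omega)⟩

theorem bumpMap_congr {e : Fin n → Bool} {J : ℕ} {c v c' v' : ℕ → Fin n → Bool}
    (hc : ∀ i < J, c i = c' i) (hv : ∀ i < J, v i = v' i) :
    bumpMap e J c v = bumpMap e J c' v' := by
  have key : ∀ y, (fun i => i < J ∧ InBump e (c i) (v i) y) =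
      fun i => i < J ∧ InBump e (c' i) (v' i) y := by
    intro y
    ext i
    constructor <;> rintro ⟨hi, h⟩ <;> refine ⟨hi, ?_⟩
    · rwa [← hc i hi, ← hv i hi]
    · rwa [hc i hi, hv i hi]
  have choose_eq : ∀ (P Q : ℕ → Prop), P = Q → ∀ (hP : ∃ i, P i) (hQ : ∃ i, Q i),
      hP.choose = hQ.choose := by
    rintro P _ rfl _ _
    rfl
  ext1 y
  unfold bumpMap
  by_cases h : ∃ i < J, InBump e (c i) (v i) y
  · have h' : ∃ i < J, InBump e (c' i) (v' i) y := by
      obtain ⟨i, hi⟩ := h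
      exact ⟨i, (congrFun (key y) i).mp hi⟩
    have hJ := h.choose_spec.1
    rw [dif_pos h, dif_pos h', hc _ hJ, hv _ hJ, choose_eq _ _ (key y) h h']
  · have h' : ¬ ∃ i < J, InBump e (c' i) (v' i) y := by
      rintro ⟨i, hi⟩
      exact h ⟨i, (congrFun (key y) i).mpr hi⟩
    rw [dif_neg h, dif_neg h']

theorem bumpMap_of_notInBump {e : Fin n → Bool} {J : ℕ} {c v : ℕ → Fin n → Bool}
    {y : Fin n → Bool} (h : ∀ i < J, ¬ InBump e (c i) (v i) y) :
    bumpMap e J c v y = parityDefault e y := by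
  unfold bumpMap
  rw [dif_neg]
  rintro ⟨i, hi, hy⟩
  exact h i hi hy

theorem Separated.eq_of_inBump {e : Fin n → Bool} {J : ℕ} {c v : ℕ → Fin n → Bool}
    (hs : Separated e J c v) {y y' : Fin n → Bool} (hy : hammingDist y y' ≤ 1) {i j : ℕ}
    (hi : i < J) (hj : j < J) (h1 : InBump e (c i) (v i) y) (h2 : InBump e (c j) (v j) y') :
    i = j := by
  by_contra hne
  have := hs.disjoint i hi j hj hne
  have h3 := hammingDist_triangle (c i) y (c j)
  have h4 := hammingDist_triangle y y' (c j)
  rw [hammingDist_comm (c i) y] at h3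
  unfold InBump at h1 h2
  omega

theorem Separated.bumpMap_of_inBump {e : Fin n → Bool} {J : ℕ} {c v : ℕ → Fin n → Bool}
    (hs : Separated e J c v) {y : Fin n → Bool} {i : ℕ} (hi : i < J)
    (h : InBump e (c i) (v i) y) :
    bumpMap e J c v y = walkTo e (v i) (bumpRadius e (v i) - hammingDist y (c i)) := by
  have hex : ∃ i < J, InBump e (c i) (v i) y := ⟨i, hi, h⟩
  unfold bumpMap
  rw [dif_pos hex]
  have : hex.choose = i :=
    hs.eq_of_inBump (by simp) hex.choose_spec.1 hi hex.choose_spec.2 h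
  rw [this]

theorem Separated.bumpMap_center {e : Fin n → Bool} {J : ℕ} {c v : ℕ → Fin n → Bool}
    (hs : Separated e J c v) {i : ℕ} (hi : i < J) (h : e ≠ v i) :
    bumpMap e J c v (c i) = v i := by
  have := hammingDist_pos.2 h
  rw [hs.bumpMap_of_inBump hi (by simp [InBump, bumpRadius]; omega)]
  simpa [bumpRadius] using walkTo_end e (v i)

/-- The default value and a bump differ at neighbouring points exactly in one bit. -/
theorem Separated.hammingDist_boundary {e : Fin n → Bool} {J : ℕ} {c v : ℕ → Fin n → Bool}
    (hs : Separated e J c v) {y y' : Fin n → Bool} (hy : hammingDist y y' = 1) {i : ℕ}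
    (hi : i < J) (h1 : InBump e (c i) (v i) y) (h2 : ¬ InBump e (c i) (v i) y') :
    hammingDist (walkTo e (v i) (bumpRadius e (v i) - hammingDist y (c i)))
      (parityDefault e y') = 1 := by
  have h3 := hammingDist_triangle y' y (c i)
  rw [hammingDist_comm y' y] at h3
  have hpar := hs.parity i hi
  have ht := even_hammingDist_triangle y y' (c i)
  have ht' := even_hammingDist_triangle y' (c i) (zeroString n)
  unfold InBump at h1 h2
  -- `y` lies on the outermost sphere of the bump, so `y'` has odd weight
  have h4 : bumpRadius e (v i) - hammingDist y (c i) = 2 := by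
    have : ¬ Even (hammingDist y' (c i) + hammingDist y (c i)) := by
      intro h
      rw [hy] at ht
      have : Even (1 : ℕ) := by
        have := (Nat.even_add.1 (by simpa [add_assoc] using ht)).2 h
        exact this
      simp at this
    have h5 : hammingDist y' (c i) ≠ hammingDist y (c i) := by
      intro h; rw [h] at this; exact this ⟨_, rfl⟩
    omega
  have h6 : hammingDist y' (c i) = bumpRadius e (v i) - 1 := by omega
  have h7 : ¬ Even (hammingDist y' (zeroString n)) := by
    intro h
    rw [Nat.even_iff] at hpar ht' h
    omega
  rw [h4, parityDefault, if_neg h7, hammingDist_comm]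
  simpa using hammingDist_walkTo_succ hs.weight_one (v i) (k := 1)
    (by unfold bumpRadius at h1; omega)

theorem Separated.bumpMap_strict {e : Fin n → Bool} {J : ℕ} {c v : ℕ → Fin n → Bool}
    (hs : Separated e J c v) (y y' : Fin n → Bool) (hy : hammingDist y y' = 1) :
    hammingDist (bumpMap e J c v y) (bumpMap e J c v y') = 1 := by
  have hy' : hammingDist y' y = 1 := by rwa [hammingDist_comm]
  by_cases h : ∃ i < J, InBump e (c i) (v i) y
  · obtain ⟨i, hi, hiy⟩ := h
    rw [hs.bumpMap_of_inBump hi hiy]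
    by_cases h' : ∃ j < J, InBump e (c j) (v j) y'
    · obtain ⟨j, hj, hjy⟩ := h'
      obtain rfl := hs.eq_of_inBump hy.le hi hj hiy hjy
      rw [hs.bumpMap_of_inBump hi hjy]
      have h3 := hammingDist_triangle y' y (c i)
      have h4 := hammingDist_triangle y y' (c i)
      have ht := even_hammingDist_triangle y y' (c i)
      rw [hy, Nat.even_iff] at ht
      unfold InBump at hiy hjy
      rcases (show hammingDist y (c i) = hammingDist y' (c i) + 1 ∨
        hammingDist y' (c i) = hammingDist y (c i) + 1 by omega) with hd | hd
      · rw [show bumpRadius e (v i) - hammingDist y' (c i) =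
          (bumpRadius e (v i) - hammingDist y (c i)) + 1 by omega]
        refine hammingDist_walkTo_succ hs.weight_one _ ?_
        unfold bumpRadius at *; omega
      · rw [show bumpRadius e (v i) - hammingDist y (c i) =
          (bumpRadius e (v i) - hammingDist y' (c i)) + 1 by omega, hammingDist_comm]
        refine hammingDist_walkTo_succ hs.weight_one _ ?_
        unfold bumpRadius at *; omega
    · push Not at h'
      rw [bumpMap_of_notInBump h']
      exact hs.hammingDist_boundary hy hi hiy (h' i hi)
  · push Not at h
    rw [bumpMap_of_notInBump h]
    by_cases h' : ∃ j < J, InBump e (c j) (v j) y'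
    · obtain ⟨j, hj, hjy⟩ := h'
      rw [hs.bumpMap_of_inBump hj hjy, hammingDist_comm]
      exact hs.hammingDist_boundary hy' hj hjy (h j hj)
    · push Not at h'
      rw [bumpMap_of_notInBump h']
      have ht := even_hammingDist_triangle y y' (zeroString n)
      rw [hy] at ht
      unfold parityDefault
      have h1 := hs.weight_one
      have h2 : hammingDist (zeroString n) e = 1 := by rwa [hammingDist_comm]
      rw [Nat.even_iff] at ht
      split_ifs with ha hb hb <;> first | assumption | (rw [Nat.even_iff] at ha hb; omega)

/-- Maps with different numbers of bumps differ only inside the additional bumps. -/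
theorem Separated.bumpMap_eq_of_notInBump {e : Fin n → Bool} {J J' : ℕ}
    {c v : ℕ → Fin n → Bool} (hs : Separated e J c v) (hJ : J' ≤ J) {y : Fin n → Bool}
    (h : ∀ i, J' ≤ i → i < J → ¬ InBump e (c i) (v i) y) :
    bumpMap e J c v y = bumpMap e J' c v y := by
  by_cases h' : ∃ i < J', InBump e (c i) (v i) y
  · obtain ⟨i, hi, hiy⟩ := h'
    rw [hs.bumpMap_of_inBump (by omega) hiy, (hs.mono hJ).bumpMap_of_inBump hi hiy]
  · push Not at h'
    rw [bumpMap_of_notInBump h', bumpMap_of_notInBump]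
    intro i hi
    by_cases hi' : i < J'
    · exact h' i hi'
    · exact h i (by omega) hi

theorem Separated.hammingDist_bumpMap_le {e : Fin n → Bool} {J W : ℕ}
    {c v : ℕ → Fin n → Bool} (hs : Separated e J c v) (hW : 1 ≤ W)
    (h : ∀ i < J, bumpRadius e (v i) ≤ W) (y : Fin n → Bool) :
    hammingDist (bumpMap e J c v y) (zeroString n) ≤ W := by
  by_cases h' : ∃ i < J, InBump e (c i) (v i) y
  · obtain ⟨i, hi, hiy⟩ := h'
    rw [hs.bumpMap_of_inBump hi hiy]
    refine (hammingDist_walkTo_le hs.weight_one _ ?_).trans ((Nat.sub_le _ _).trans (h i hi))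
    exact Nat.sub_le _ _
  · push Not at h'
    rw [bumpMap_of_notInBump h', parityDefault]
    split_ifs
    · simp
    · rw [hs.weight_one]; exact hW

end Bump

/-! ### Stretched strings and a code of sets with small intersections -/

section Code

/-- The string of length `n` in which every position `j` of `v` is repeated `b` times; the part
that does not fit is lost. -/
def stretch {n : ℕ} (b : ℕ) (v : Fin n → Bool) : Fin n → Bool :=
  fun j => v ⟨j / b, (Nat.div_le_self _ _).trans_lt j.2⟩

/-- The characteristic string of `S`, stretched by the factor `b`. -/
def blockString (n b : ℕ) (S : Finset ℕ) : Fin n → Bool := fun j => decide ((j : ℕ) / b ∈ S)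

theorem stretch_blockString (n b : ℕ) (S : Finset ℕ) :
    stretch b (blockString n 1 S) = blockString n b S := by
  ext j
  simp [stretch, blockString]

theorem blockString_empty (n b : ℕ) : blockString n b ∅ = zeroString n := by
  ext j
  simp [blockString, zeroString]

theorem hammingDist_blockString {n b : ℕ} (hb : 0 < b) {S S' : Finset ℕ}
    (hS : ∀ s ∈ S, b * (s + 1) ≤ n) (hS' : ∀ s ∈ S', b * (s + 1) ≤ n) :
    hammingDist (blockString n b S) (blockString n b S') = b * (symmDiff S S').card := by
  rw [mul_comm, ← Finset.card_range b, ← Finset.card_product, Finset.card_range, hammingDist]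
  refine Finset.card_bij (fun j _ => ((j : ℕ) / b, (j : ℕ) % b)) ?_ ?_ ?_
  · intro j hj
    simp only [blockString, ne_eq, decide_eq_decide, Finset.mem_filter, Finset.mem_univ,
      true_and] at hj
    simp only [Finset.mem_product, Finset.mem_symmDiff, Finset.mem_range, Nat.mod_lt _ hb, and_true]
    tauto
  · intro i _ j _ h
    simp only [Prod.mk.injEq] at h
    ext
    rw [← Nat.div_add_mod (i : ℕ) b, h.1, h.2, Nat.div_add_mod]
  · rintro ⟨s, z⟩ h
    simp only [Finset.mem_product, Finset.mem_symmDiff, Finset.mem_range] at h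
    have hs : b * (s + 1) ≤ n := by
      rcases h.1 with h | h
      · exact hS s h.1
      · exact hS' s h.1
    have hdiv : (b * s + z) / b = s := by
      rw [Nat.mul_add_div hb, Nat.div_eq_of_lt h.2, add_zero]
    refine ⟨⟨b * s + z, by rw [mul_add] at hs; omega⟩, ?_, ?_⟩
    · simp only [blockString, ne_eq, decide_eq_decide, Finset.mem_filter, Finset.mem_univ,
        true_and, hdiv]
      tauto
    · simp only [hdiv, Prod.mk.injEq, true_and]
      rw [Nat.mul_add_mod, Nat.mod_eq_of_lt h.2]

/-- The graph of `g` over the first `l` points of `ZMod P`, as a set of numbers, together with the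
marker `0`. The number `1` is left out. -/
noncomputable def codeSet (P l : ℕ) (g : Polynomial (ZMod P)) : Finset ℕ :=
  insert 0 ((Finset.range l).image fun a : ℕ => 2 + a * P + (g.eval (a : ZMod P)).val)

variable {P : ℕ} [hP : Fact P.Prime]

theorem lt_of_mem_codeSet {l : ℕ} (hl : l ≤ P) {g : Polynomial (ZMod P)} {s : ℕ}
    (hs : s ∈ codeSet P l g) : s < 2 + P * P := by
  simp only [codeSet, Finset.mem_insert, Finset.mem_image, Finset.mem_range] at hs
  rcases hs with rfl | ⟨a, ha, rfl⟩
  · omega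
  · have h1 := ZMod.val_lt (g.eval (a : ZMod P))
    have h2 : (a + 1) * P ≤ P * P := Nat.mul_le_mul_right _ (by omega)
    rw [add_mul] at h2
    omega

theorem graph_injective {a a' z z' : ℕ} (hz : z < P) (hz' : z' < P)
    (h : 2 + a * P + z = 2 + a' * P + z') : a = a' ∧ z = z' := by
  have h0 : P * a + z = P * a' + z' := by rw [mul_comm P, mul_comm P]; omega
  have h1 := congrArg (· / P) h0
  simp only [Nat.mul_add_div hP.out.pos, Nat.div_eq_of_lt hz, Nat.div_eq_of_lt hz',
    add_zero] at h1
  subst h1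
  omega

theorem card_codeSet (l : ℕ) (g : Polynomial (ZMod P)) : (codeSet P l g).card = l + 1 := by
  rw [codeSet, Finset.card_insert_of_notMem, Finset.card_image_of_injective, Finset.card_range]
  · intro a a' h
    exact (graph_injective (ZMod.val_lt _) (ZMod.val_lt _) h).1
  · simp

theorem one_notMem_codeSet (l : ℕ) (g : Polynomial (ZMod P)) : 1 ∉ codeSet P l g := by
  simp only [codeSet, Finset.mem_insert, Finset.mem_image, Finset.mem_range]
  rintro (h | ⟨a, -, h⟩) <;> omega

theorem card_codeSet_inter_le {l l' t : ℕ} (hl : l ≤ P) {g g' : Polynomial (ZMod P)}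
    (hg : g ∈ Polynomial.degreeLT (ZMod P) t) (hg' : g' ∈ Polynomial.degreeLT (ZMod P) t)
    (hne : g ≠ g') : (codeSet P l g ∩ codeSet P l' g').card ≤ t := by
  have hsub : g - g' ≠ 0 := sub_ne_zero.2 hne
  have hdeg : (g - g').natDegree < t := by
    rw [Polynomial.natDegree_lt_iff_degree_lt hsub]
    exact Polynomial.mem_degreeLT.1 (Submodule.sub_mem _ hg hg')
  have h1 : codeSet P l g ∩ codeSet P l' g' ⊆ insert 0 ((g - g').roots.toFinset.image
      fun a => 2 + a.val * P + (g.eval a).val) := by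
    intro s hs
    simp only [codeSet, Finset.mem_inter, Finset.mem_insert, Finset.mem_image,
      Finset.mem_range] at hs
    rw [Finset.mem_insert, Finset.mem_image]
    rcases hs with ⟨rfl | ⟨a, ha, rfl⟩, h⟩
    · exact Or.inl rfl
    · rcases h with h | ⟨a', ha', h⟩
      · omega
      · obtain ⟨rfl, hz⟩ := graph_injective (ZMod.val_lt _) (ZMod.val_lt _) h
        refine Or.inr ⟨(a' : ZMod P), ?_, ?_⟩
        · rw [Multiset.mem_toFinset, Polynomial.mem_roots hsub, Polynomial.IsRoot,
            Polynomial.eval_sub, sub_eq_zero]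
          exact (ZMod.val_injective P hz).symm
        · rw [ZMod.val_natCast_of_lt (by omega)]
  calc _ ≤ _ := Finset.card_le_card h1
    _ ≤ ((g - g').roots.toFinset.image fun a => 2 + a.val * P + (g.eval a).val).card + 1 :=
      Finset.card_insert_le _ _
    _ ≤ (g - g').natDegree + 1 := by
      gcongr
      exact Finset.card_image_le.trans ((Multiset.toFinset_card_le _).trans
        (Polynomial.card_roots' _))
    _ ≤ t := hdeg

theorem card_degreeLT (t : ℕ) : Nat.card (Polynomial.degreeLT (ZMod P) t) = P ^ t := by
  rw [Nat.card_congr (Polynomial.degreeLTEquiv (ZMod P) t).toEquiv]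
  simp

theorem le_card_symmDiff_codeSet {l l' t : ℕ} (hl : l ≤ P) {g g' : Polynomial (ZMod P)}
    (hg : g ∈ Polynomial.degreeLT (ZMod P) t) (hg' : g' ∈ Polynomial.degreeLT (ZMod P) t)
    (hne : g ≠ g') :
    l + l' + 2 ≤ (symmDiff (codeSet P l g) (codeSet P l' g')).card + 2 * t := by
  have h1 := card_codeSet_inter_le (l' := l') hl hg hg' hne
  have h2 := Finset.card_sdiff_add_card_inter (codeSet P l g) (codeSet P l' g')
  have h3 := Finset.card_sdiff_add_card_inter (codeSet P l' g') (codeSet P l g)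
  rw [Finset.inter_comm] at h3
  rw [card_codeSet] at h2 h3
  have h4 : (symmDiff (codeSet P l g) (codeSet P l' g')).card =
      (codeSet P l g \ codeSet P l' g').card + (codeSet P l' g' \ codeSet P l g).card := by
    rw [symmDiff_def, Finset.sup_eq_union, Finset.card_union_of_disjoint]
    exact disjoint_sdiff_sdiff
  omega

end Code

/-! ### Greedy choice of a chain of oracles -/

section Chain

/-- Strings computed by alternating stretching and the oracle, starting from `X`. -/
def stretchIter {n : ℕ} (b : ℕ) (f : (Fin n → Bool) → (Fin n → Bool)) (X : Fin n → Bool) :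
    ℕ → (Fin n → Bool)
  | 0 => X
  | i + 1 => f (stretch b (stretchIter b f X i))

theorem exists_greedy {G : Type*} [Nonempty G] (T : ℕ) (bad : ℕ → (ℕ → G) → Set G)
    (hcongr : ∀ i g g', (∀ j < i, g j = g' j) → bad i g = bad i g')
    (hne : ∀ i ≤ T, ∀ g, ∃ x, x ∉ bad i g) : ∃ g : ℕ → G, ∀ i ≤ T, g i ∉ bad i g := by
  suffices ∀ m ≤ T + 1, ∃ g : ℕ → G, ∀ i < m, g i ∉ bad i g by
    obtain ⟨g, hg⟩ := this (T + 1) le_rfl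
    exact ⟨g, fun i hi => hg i (by omega)⟩
  intro m
  induction m with
  | zero => exact fun _ => ⟨fun _ => Classical.arbitrary G, by simp⟩
  | succ m ih =>
    intro hm
    obtain ⟨g, hg⟩ := ih (by omega)
    obtain ⟨x, hx⟩ := hne m (by omega) g
    refine ⟨Function.update g m x, fun i hi => ?_⟩
    rw [hcongr i _ g fun j hj => Function.update_of_ne (by omega) _ _]
    rcases Nat.lt_succ_iff_lt_or_eq.1 hi with h | rfl
    · rw [Function.update_of_ne (by omega)]
      exact hg i h
    · rwa [Function.update_self]

/-- Oracles `F 0, …, F T` on `n` bits that a circuit with few queries cannot tell apart quickly: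
`F i` and `F j` differ only in the regions `near s` for `s` between `j` and `i`, the queries
`Q (F j)` keep the distance `gap` from all later regions, and the last two oracles lead to
different values of the iteration `stretchIter`. -/
structure FoolingChain (n b T W gap : ℕ) (X : Fin n → Bool)
    (Q : ((Fin n → Bool) → (Fin n → Bool)) → Finset (Fin n → Bool)) where
  /-- The oracles. -/
  F : ℕ → (Fin n → Bool) → (Fin n → Bool)
  /-- The regions in which consecutive oracles differ. -/
  near : ℕ → (Fin n → Bool) → Prop
  strict : ∀ j ≤ T, ∀ x y, hammingDist x y = 1 → hammingDist (F j x) (F j y) = 1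
  eq_off : ∀ i ≤ T, ∀ j ≤ i, ∀ y, (∀ s, j ≤ s → s < i → ¬ near s y) → F i y = F j y
  far : ∀ s < T, ∀ j < s, ∀ y ∈ Q (F j), ∀ z, near s z → gap ≤ hammingDist y z
  bounded : ∀ j ≤ T, ∀ y, hammingDist (F j y) (zeroString n) ≤ W
  final_true : ∀ i : Fin n, (i : ℕ) = 0 → stretchIter b (F T) X T i = true
  final_false : ∀ i : Fin n, (i : ℕ) = 0 → stretchIter b (F (T - 1)) X T i = false

/-- The length of the `i`-th codeword. It decreases by more than twice the size of the possible
intersections, which leaves room for the bumps when nothing is stretched. -/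
def codeLength (t T i : ℕ) : ℕ := 2 * (t + 3) * (2 * T + 2 - i)

theorem codeLength_succ {t T i : ℕ} (hi : i ≤ T) :
    codeLength t T i = codeLength t T (i + 1) + 2 * (t + 3) := by
  unfold codeLength
  rw [show 2 * T + 2 - i = (2 * T + 2 - (i + 1)) + 1 by omega, mul_add, mul_one]

theorem codeLength_le (t T i : ℕ) : codeLength t T i ≤ codeLength t T 0 :=
  Nat.mul_le_mul_left _ (by omega)

theorem even_codeLength (t T i : ℕ) : Even (codeLength t T i) := by
  unfold codeLength
  rw [mul_assoc]
  exact even_two_mul _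

/-- The string that every chain starts from: the longest codeword of the zero polynomial. -/
noncomputable def chainStart (n t T P : ℕ) : Fin n → Bool :=
  blockString n 1 (codeSet P (codeLength t T 0) 0)

theorem exists_foolingChain {n b t T P q gap : ℕ} [hP : Fact P.Prime] (hb : Odd b) (ht : 1 ≤ t)
    (hT : 1 ≤ T)
    (hPn : b * (2 + P * P) ≤ n) (hLP : codeLength t T 0 ≤ P) (hq : T * (q + 1) < P ^ t)
    (hgap : ∀ s < T, codeLength t T (s + 1) + gap + 1 ≤ b * (codeLength t T s + 1 - t))
    (Q : ((Fin n → Bool) → (Fin n → Bool)) → Finset (Fin n → Bool))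
    (hQ : ∀ f, (Q f).card ≤ q) :
    Nonempty (FoolingChain n b T (codeLength t T 0) gap (chainStart n t T P) Q) := by
  classical
  let G := Polynomial.degreeLT (ZMod P) t
  let S : ℕ → G → Finset ℕ := fun i g => codeSet P (codeLength t T i) g.1
  let e : Fin n → Bool := blockString n 1 {1}
  let v : ℕ → G → Fin n → Bool := fun i g => blockString n 1 (S i g)
  let c : ℕ → G → Fin n → Bool := fun i g => blockString n b (S i g)
  let F : (ℕ → G) → ℕ → (Fin n → Bool) → (Fin n → Bool) := fun g j =>
    bumpMap e j (fun i => c i (g i)) (fun i => v (i + 1) (g (i + 1)))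
  let ρ : ℕ → ℕ := fun i => b * (codeLength t T i + 1 - t)
  have hb0 : 0 < b := hb.pos
  have hlen : ∀ i, codeLength t T i ≤ P := fun i => (codeLength_le t T i).trans hLP
  -- all blocks of the stretched codewords fit into the string
  have hfit : ∀ i g, ∀ s ∈ S i g, b * (s + 1) ≤ n := fun i g s hs =>
    (Nat.mul_le_mul_left b (lt_of_mem_codeSet (hlen i) hs)).trans hPn
  have hfit1 : ∀ i g, ∀ s ∈ S i g, 1 * (s + 1) ≤ n := fun i g s hs =>
    (Nat.mul_le_mul_right _ hb0).trans (hfit i g s hs)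
  have hn2 : 2 ≤ n := by
    refine le_trans ?_ ((Nat.mul_le_mul_right _ hb0).trans hPn)
    omega
  have hfite : ∀ s ∈ ({1} : Finset ℕ), 1 * (s + 1) ≤ n := by
    intro s hs
    rw [Finset.mem_singleton.1 hs]
    omega
  have hcard : ∀ i g, (S i g).card = codeLength t T i + 1 := fun i g => card_codeSet _ _
  have he : hammingDist e (zeroString n) = 1 := by
    rw [← blockString_empty n 1, hammingDist_blockString one_pos hfite (by simp),
      ← Finset.bot_eq_empty, symmDiff_bot]
    simp
  have hcc : ∀ i j g g', g ≠ g' →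
      b * (codeLength t T i + codeLength t T j + 2 - 2 * t) ≤ hammingDist (c i g) (c j g') := by
    intro i j g g' hne
    rw [hammingDist_blockString hb0 (hfit i g) (hfit j g')]
    refine Nat.mul_le_mul_left b ?_
    have := le_card_symmDiff_codeSet (l := codeLength t T i) (l' := codeLength t T j) (hlen i)
      g.2 g'.2 (fun h => hne (Subtype.ext h))
    simp only [S]
    omega
  have hev : ∀ i g, hammingDist e (v i g) = codeLength t T i + 2 := by
    intro i g
    rw [hammingDist_blockString one_pos hfite (hfit1 i g), one_mul, symmDiff_def,
      Finset.sup_eq_union, Finset.card_union_of_disjoint disjoint_sdiff_sdiff,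
      Finset.sdiff_singleton_eq_erase, Finset.erase_eq_of_notMem (one_notMem_codeSet _ _), hcard,
      Finset.sdiff_eq_self_of_disjoint
        (Finset.disjoint_singleton_left.2 (one_notMem_codeSet _ _)), Finset.card_singleton]
    omega
  have hrad : ∀ i g, bumpRadius e (v i g) = codeLength t T i + 3 := by
    intro i g
    rw [bumpRadius, hev]
  -- the choice of the codewords
  let bad : ℕ → (ℕ → G) → Set G := fun i g =>
    if i = 0 then {x | x ≠ 0} else
      {x | (∃ j < i, g j = x) ∨ ∃ j < i, ∃ y ∈ Q (F g j), hammingDist y (c i x) < ρ i}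
  have hF : ∀ i g g', (∀ j ≤ i, g j = g' j) → F g i = F g' i := by
    intro i g g' h
    refine bumpMap_congr (fun j hj => ?_) fun j hj => ?_
    · simp only [h j hj.le]
    · simp only [h (j + 1) hj]
  obtain ⟨g, hg⟩ : ∃ g : ℕ → G, ∀ i ≤ T, g i ∉ bad i g := by
    refine exists_greedy T bad ?_ ?_
    · intro i g g' h
      simp only [bad]
      split_ifs with hi
      · rfl
      · ext x
        simp only [Set.mem_ofPred_eq]
        refine or_congr ?_ ?_
        · exact exists_congr fun j => and_congr_right fun hj => by rw [h j hj]
        · exact exists_congr fun j => and_congr_right fun hj => by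
            rw [hF j g g' fun k hk => h k (by omega)]
    · intro i hi g
      by_cases h0 : i = 0
      · exact ⟨0, by simp [bad, h0]⟩
      by_contra! hall
      -- every string is close to the centre of at most one codeword
      have hcov : (Set.univ : Set G) ⊆ ↑((Finset.range i).image g ∪
          ((Finset.range i).sigma fun j => Q (F g j)).image fun p =>
            if h : ∃ x, hammingDist p.2 (c i x) < ρ i then h.choose else 0) := by
        intro x _
        have hx := hall x
        simp only [bad, if_neg h0, Set.mem_ofPred_eq] at hx
        simp only [Finset.coe_union, Finset.coe_image, Set.mem_union, Set.mem_image,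
          Finset.mem_coe, Finset.mem_range, Finset.mem_sigma]
        rcases hx with ⟨j, hj, hx⟩ | ⟨j, hj, y, hy, hx⟩
        · exact Or.inl ⟨j, hj, hx⟩
        · refine Or.inr ⟨⟨j, y⟩, ⟨hj, hy⟩, ?_⟩
          have hex : ∃ x, hammingDist y (c i x) < ρ i := ⟨x, hx⟩
          rw [dif_pos hex]
          by_contra hne
          have h1 := hcc i i _ _ hne
          have h2 := hex.choose_spec
          have h3 := hammingDist_triangle (c i hex.choose) y (c i x)
          rw [hammingDist_comm (c i hex.choose) y] at h3
          have h4 : b * (codeLength t T i + codeLength t T i + 2 - 2 * t) = 2 * ρ i := by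
            rw [show codeLength t T i + codeLength t T i + 2 - 2 * t =
              2 * (codeLength t T i + 1 - t) by omega]
            simp only [ρ]
            ring
          omega
      have h1 := Set.ncard_le_ncard hcov (Finset.finite_toSet _)
      rw [Set.ncard_univ, card_degreeLT, Set.ncard_coe_finset] at h1
      have h2 := Finset.card_union_le ((Finset.range i).image g)
          (((Finset.range i).sigma fun j => Q (F g j)).image fun p =>
            if h : ∃ x, hammingDist p.2 (c i x) < ρ i then h.choose else 0)
      have h3 : ((Finset.range i).image g).card ≤ i :=
        Finset.card_image_le.trans (Finset.card_range i).le
      have h4 : (((Finset.range i).sigma fun j => Q (F g j)).image fun p =>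
            if h : ∃ x, hammingDist p.2 (c i x) < ρ i then h.choose else 0).card ≤ i * q := by
        refine Finset.card_image_le.trans ?_
        rw [Finset.card_sigma]
        refine (Finset.sum_le_card_nsmul _ _ q fun j _ => hQ _).trans ?_
        simp
      have h5 : i * (q + 1) ≤ T * (q + 1) := Nat.mul_le_mul_right _ hi
      rw [mul_add] at h5
      omega
  have hg0 : g 0 = 0 := by
    have := hg 0 (by omega)
    simpa [bad] using this
  have hinj : ∀ i ≤ T, ∀ j < i, g j ≠ g i := by
    intro i hi j hj h
    have := hg i hi
    simp only [bad, if_neg (show i ≠ 0 by omega), Set.mem_ofPred_eq, not_or] at this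
    exact this.1 ⟨j, hj, h⟩
  have hfar : ∀ i ≤ T, ∀ j < i, ∀ y ∈ Q (F g j), ρ i ≤ hammingDist y (c i (g i)) := by
    intro i hi j hj y hy
    have := hg i hi
    simp only [bad, if_neg (show i ≠ 0 by omega), Set.mem_ofPred_eq, not_or] at this
    by_contra! h
    exact this.2 ⟨j, hj, y, hy, h⟩
  have hsep : Separated e T (fun i => c i (g i)) (fun i => v (i + 1) (g (i + 1))) := by
    refine ⟨he, ?_, ?_⟩
    · intro i hi j hj hij
      have hne : g i ≠ g j := by
        rcases lt_or_gt_of_ne hij with h | h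
        · exact hinj j hj.le i h
        · exact (hinj i hi.le j h).symm
      refine le_trans ?_ (hcc i j _ _ hne)
      refine le_trans ?_ (Nat.le_mul_of_pos_left _ hb0)
      rw [hrad, hrad, codeLength_succ hi.le, codeLength_succ hj.le]
      omega
    · intro i hi
      rw [hrad, ← blockString_empty n b, hammingDist_blockString hb0 (hfit i _) (by simp)]
      have h1 := even_codeLength t T i
      have h2 := even_codeLength t T (i + 1)
      have h3 : (symmDiff (S i (g i)) ∅).card = codeLength t T i + 1 := by
        rw [← hcard i (g i), ← Finset.bot_eq_empty, symmDiff_bot]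
      rw [h3]
      -- both the radius and the weight of the centre are odd, since `b` is odd
      have h4 : Odd (b * (codeLength t T i + 1)) := hb.mul h1.add_one
      have h5 : Odd (codeLength t T (i + 1) + 3) := h2.add_odd (by decide)
      exact h5.add_odd h4
  have hstretch : ∀ i, stretch b (v i (g i)) = c i (g i) := fun i => stretch_blockString _ _ _
  have hne_e : ∀ i, e ≠ v i (g i) := by
    intro i h
    have := hev i (g i)
    rw [← h, hammingDist_self] at this
    omega
  have hiter : ∀ j ≤ T, ∀ i ≤ j,
      stretchIter b (F g j) (chainStart n t T P) i = v i (g i) := by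
    intro j hj i
    induction i with
    | zero =>
      intro _
      simp only [stretchIter, chainStart, v, S, hg0]
      rfl
    | succ i ih =>
      intro hi
      rw [stretchIter, ih (by omega), hstretch]
      exact (hsep.mono hj).bumpMap_center (i := i) (by omega) (hne_e _)
  refine ⟨⟨F g, fun s y => InBump e (c s (g s)) (v (s + 1) (g (s + 1))) y, ?_, ?_, ?_, ?_, ?_, ?_⟩⟩
  · exact fun j hj => (hsep.mono hj).bumpMap_strict
  · exact fun i hi j hj y hy => (hsep.mono hi).bumpMap_eq_of_notInBump hj hy
  · intro s hs j hj y hy z hz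
    have h1 := hfar s hs.le j hj y hy
    have h2 := hammingDist_triangle y z (c s (g s))
    have h3 := hgap s hs
    unfold InBump at hz
    rw [hrad] at hz
    simp only [ρ] at h1
    omega
  · intro j hj y
    refine (hsep.mono hj).hammingDist_bumpMap_le ?_ ?_ y
    · rw [codeLength_succ (by omega)]; omega
    · intro i hi
      rw [hrad]
      have := codeLength_le t T i
      rw [codeLength_succ (by omega)] at this
      omega
  · intro i hi
    rw [hiter T le_rfl T le_rfl]
    simp [v, S, blockString, codeSet, hi]
  · intro i hi
    obtain ⟨T, rfl⟩ := Nat.exists_eq_add_of_le' hT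
    rw [Nat.add_sub_cancel, stretchIter, hiter T (by omega) T le_rfl, hstretch]
    have : F g T (c T (g T)) = parityDefault e (c T (g T)) := by
      refine bumpMap_of_notInBump fun i hi => ?_
      have h1 := hsep.disjoint i (by omega) T (by omega) hi.ne
      unfold InBump
      rw [hammingDist_comm] at h1
      rw [hrad, hrad] at h1
      rw [hrad]
      omega
    rw [this, parityDefault]
    split_ifs
    · rfl
    · simp [e, blockString, hi]

end Chain

/-! ### Boolean circuits of small oracle depth -/

namespace Gates

variable {n : ℕ}

/-- The strings that the oracle gates query. -/
def queries (f : (Fin n → Bool) → (Fin n → Bool)) (X : Fin n → Bool) :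
    {w : ℕ} → Gates n w → List (Fin n → Bool)
  | _, inputs => []
  | _, const C _ => C.queries f X
  | _, not C _ => C.queries f X
  | _, and C _ _ => C.queries f X
  | _, or C _ _ => C.queries f X
  | _, oracle C src => (fun j => C.eval f X (src j)) :: C.queries f X

theorem length_queries_le (f : (Fin n → Bool) → (Fin n → Bool)) (X : Fin n → Bool) {w : ℕ}
    (C : Gates n w) : (C.queries f X).length ≤ C.rows.length := by
  induction C <;> simp [queries, rows] <;> omega

/-- A value of oracle depth at most `j` does not depend on which of the oracles `F j, …, F T` is
used, if under `F j` no query enters a region `near s` with `s > j`. -/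
theorem eval_eq_of_oracleDepth_le {F : ℕ → (Fin n → Bool) → (Fin n → Bool)}
    {near : ℕ → (Fin n → Bool) → Prop} {T : ℕ} {X : Fin n → Bool}
    (eq_off : ∀ i ≤ T, ∀ j ≤ i, ∀ y, (∀ s, j ≤ s → s < i → ¬ near s y) → F i y = F j y)
    {w : ℕ} (C : Gates n w)
    (far : ∀ s < T, ∀ j < s, ∀ y ∈ C.queries (F j) X, ¬ near s y) :
    ∀ i ≤ T, ∀ j ≤ i, ∀ x, C.oracleDepth x ≤ j → C.eval (F i) X x = C.eval (F j) X x := by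
  induction C with
  | inputs => intros; rfl
  | const C b ih =>
    intro i hi j hj x
    refine Fin.lastCases ?_ (fun x => ?_) x
    · simp [eval]
    · simpa [eval, oracleDepth] using ih far i hi j hj x
  | not C k ih =>
    intro i hi j hj x
    refine Fin.lastCases ?_ (fun x => ?_) x
    · simpa [eval, oracleDepth] using ih far i hi j hj k
    · simpa [eval, oracleDepth] using ih far i hi j hj x
  | and C k l ih =>
    intro i hi j hj x
    refine Fin.lastCases ?_ (fun x => ?_) x
    · simp only [eval, oracleDepth, Fin.snoc_last, max_le_iff]
      rintro ⟨h1, h2⟩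
      rw [ih far i hi j hj k h1, ih far i hi j hj l h2]
    · simpa [eval, oracleDepth] using ih far i hi j hj x
  | or C k l ih =>
    intro i hi j hj x
    refine Fin.lastCases ?_ (fun x => ?_) x
    · simp only [eval, oracleDepth, Fin.snoc_last, max_le_iff]
      rintro ⟨h1, h2⟩
      rw [ih far i hi j hj k h1, ih far i hi j hj l h2]
    · simpa [eval, oracleDepth] using ih far i hi j hj x
  | oracle C src ih =>
    have far' : ∀ s < T, ∀ j < s, ∀ y ∈ C.queries (F j) X, ¬ near s y := fun s hs j hj y hy =>
      far s hs j hj y (List.mem_cons_of_mem _ hy)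
    intro i hi j hj x
    refine Fin.addCases (fun x => ?_) (fun x => ?_) x
    · simpa [eval, oracleDepth] using ih far' i hi j hj x
    · simp only [eval, oracleDepth, Fin.append_right]
      intro hd
      obtain ⟨j, rfl⟩ := Nat.exists_eq_add_of_le' (show 1 ≤ j by omega)
      have hle : ∀ k, C.oracleDepth (src k) ≤ j := fun k =>
        (Finset.le_sup (f := fun k => C.oracleDepth (src k)) (Finset.mem_univ k)).trans (by omega)
      -- the query is the same under `F i`, `F (j + 1)` and `F j`
      have h1 : (fun k => C.eval (F i) X (src k)) = fun k => C.eval (F j) X (src k) :=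
        funext fun k => ih far' i hi j (by omega) _ (hle k)
      have h2 : (fun k => C.eval (F (j + 1)) X (src k)) = fun k => C.eval (F j) X (src k) :=
        funext fun k => ih far' (j + 1) (by omega) j (by omega) _ (hle k)
      rw [h1, h2, eq_off i hi (j + 1) hj]
      intro s hjs hsi
      exact far s (by omega) j (by omega) _ (List.mem_cons_self)

end Gates

/-- A circuit of oracle depth less than `T` does not compute the iteration of length `T`. -/
theorem BooleanCircuit.eval_eq_of_foolingChain {n b T W gap : ℕ} {X : Fin n → Bool}
    (C : BooleanCircuit n) (hgap : 1 ≤ gap)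
    (A : FoolingChain n b T W gap X fun f => (C.gates.queries f X).toFinset)
    (hC : C.oracleDepth < T) : C.eval (A.F T) X = C.eval (A.F (T - 1)) X := by
  refine C.gates.eval_eq_of_oracleDepth_le A.eq_off ?_ T le_rfl (T - 1) (by omega) _ ?_
  · intro s hs j hj y hy hnear
    have := A.far s hs j hj y (List.mem_toFinset.2 hy) y hnear
    rw [hammingDist_self] at this
    omega
  · have := Finset.le_sup (f := C.gates.oracleDepth) (Finset.mem_univ C.output)
    unfold BooleanCircuit.oracleDepth at hC
    omega

/-! ### Comparator circuits and the Hamming distance of two runs -/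

namespace CGate

variable {n m : ℕ}

/-- Only the wires of the gate contribute to the change of the distance of two states. -/
theorem hammingDist_extend {κ : Type*} [Fintype κ] {src src' : κ → Fin m}
    (hsrc : Function.Injective src) (hsrc' : Function.Injective src')
    (hrange : Finset.univ.image src' = Finset.univ.image src) (s s' : Fin m → Bool)
    (u u' : κ → Bool) :
    hammingDist (Function.extend src' u s) (Function.extend src' u' s') +
      hammingDist (fun k => s (src k)) (fun k => s' (src k)) =
    hammingDist s s' + hammingDist u u' := by
  classical
  simp only [hammingDist_eq_sum]
  rw [← Finset.sum_add_sum_compl (Finset.univ.image src)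
      (fun w => if Function.extend src' u s w ≠ Function.extend src' u' s' w then 1 else 0),
    ← Finset.sum_add_sum_compl (Finset.univ.image src) (fun w => if s w ≠ s' w then 1 else 0)]
  have h1 : ∑ w ∈ Finset.univ.image src,
      (if Function.extend src' u s w ≠ Function.extend src' u' s' w then 1 else 0) =
      ∑ k, if u k ≠ u' k then 1 else 0 := by
    rw [← hrange, Finset.sum_image fun _ _ _ _ h => hsrc' h]
    simp [hsrc'.extend_apply]
  have h2 : ∑ w ∈ Finset.univ.image src, (if s w ≠ s' w then 1 else 0) =
      ∑ k, if s (src k) ≠ s' (src k) then 1 else 0 :=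
    Finset.sum_image fun _ _ _ _ h => hsrc h
  have h3 : ∑ w ∈ (Finset.univ.image src)ᶜ,
      (if Function.extend src' u s w ≠ Function.extend src' u' s' w then 1 else 0) =
      ∑ w ∈ (Finset.univ.image src)ᶜ, if s w ≠ s' w then 1 else 0 := by
    refine Finset.sum_congr rfl fun w hw => ?_
    have : ¬ ∃ k, src' k = w := by
      rw [← hrange] at hw
      simpa using hw
    rw [Function.extend_apply' _ _ _ this, Function.extend_apply' _ _ _ this]
  rw [h1, h2, h3]
  omega

theorem hammingDist_apply_oracle (f f' : (Fin n → Bool) → (Fin n → Bool)) (src : Fin n ↪ Fin m)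
    (σ : Equiv.Perm (Fin n)) (s s' : Fin m → Bool) :
    hammingDist ((oracle src σ).apply f s) ((oracle src σ).apply f' s') +
      hammingDist (fun k => s (src k)) (fun k => s' (src k)) =
    hammingDist s s' +
      hammingDist (f fun k => s (src k)) (f' fun k => s' (src k)) := by
  refine hammingDist_extend src.injective (src.injective.comp σ.injective) ?_ s s' _ _
  ext w
  simp only [Finset.mem_image, Finset.mem_univ, true_and]
  exact ⟨fun ⟨k, hk⟩ => ⟨σ k, hk⟩, fun ⟨k, hk⟩ => ⟨σ.symm k, by simpa using hk⟩⟩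

theorem hammingDist_apply_comparator (f f' : (Fin n → Bool) → (Fin n → Bool)) (i j : Fin m)
    (s s' : Fin m → Bool) :
    hammingDist ((comparator i j).apply f s) ((comparator i j).apply f' s') ≤
      hammingDist s s' := by
  by_cases hij : i = j
  · subst hij
    simp [apply]
  · have hinj : Function.Injective ![i, j] := by
      intro a b h
      fin_cases a <;> fin_cases b <;> simp_all [eq_comm]
    have key : ∀ t : Fin m → Bool, (comparator i j : CGate n m).apply f t =
        Function.extend ![i, j] ![t i && t j, t i || t j] t := by
      intro t
      ext w
      by_cases hj : w = j
      · subst hj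
        have := hinj.extend_apply ![t i && t w, t i || t w] t 1
        simp at this
        simp [apply, this]
      · by_cases hi : w = i
        · subst hi
          have := hinj.extend_apply ![t w && t j, t w || t j] t 0
          simp at this
          simp [apply, this, hj]
        · rw [Function.extend_apply' _ _ _ (by
            simpa [Fin.exists_fin_two] using ⟨Ne.symm hi, Ne.symm hj⟩)]
          simp [apply, hi, hj]
    have h := hammingDist_extend hinj hinj rfl s s' ![s i && s j, s i || s j]
      ![s' i && s' j, s' i || s' j]
    have h2 : hammingDist ![s i && s j, s i || s j] ![s' i && s' j, s' i || s' j] ≤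
        hammingDist (fun k => s (![i, j] k)) (fun k => s' (![i, j] k)) := by
      have hbool : ∀ a b a' b' : Bool,
          hammingDist ![a && b, a || b] ![a' && b', a' || b'] ≤ hammingDist ![a, b] ![a', b'] := by
        decide
      have hpair : ∀ t : Fin m → Bool, (fun k => t (![i, j] k)) = ![t i, t j] := by
        intro t
        ext k
        fin_cases k <;> rfl
      rw [hpair, hpair]
      exact hbool _ _ _ _
    rw [key, show (comparator i j).apply f' s' = (comparator i j : CGate n m).apply f s' from rfl,
      key]
    omega

theorem hammingDist_apply_negation (f f' : (Fin n → Bool) → (Fin n → Bool)) (i : Fin m)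
    (s s' : Fin m → Bool) :
    hammingDist ((negation i).apply f s) ((negation i).apply f' s') ≤ hammingDist s s' := by
  rw [hammingDist_eq_sum, hammingDist_eq_sum]
  refine Finset.sum_le_sum fun w _ => ?_
  by_cases hw : w = i
  · subst hw
    simp only [apply, Function.update_self]
    cases s w <;> cases s' w <;> decide
  · simp [apply, hw]

/-- The strings queried when the gates in the list are applied one after the other. -/
noncomputable def queries (f : (Fin n → Bool) → (Fin n → Bool)) :
    List (CGate n m) → (Fin m → Bool) → List (Fin n → Bool)
  | [], _ => []
  | comparator i j :: gs, s => queries f gs ((comparator i j).apply f s)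
  | negation i :: gs, s => queries f gs ((negation i).apply f s)
  | oracle src σ :: gs, s => (fun k => s (src k)) :: queries f gs ((oracle src σ).apply f s)

theorem length_queries_le (f : (Fin n → Bool) → (Fin n → Bool)) (gs : List (CGate n m))
    (s : Fin m → Bool) : (queries f gs s).length ≤ gs.length := by
  induction gs generalizing s with
  | nil => simp [queries]
  | cons g gs ih =>
    cases g with
    | comparator i j => exact (ih _).trans (by simp)
    | negation i => exact (ih _).trans (by simp)
    | oracle src σ =>
      simp only [queries, List.length_cons]
      have := ih ((oracle src σ).apply f s)
      omega

/-- Accounting for the distance of two runs: every query with property `B` adds at most `l`, every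
query with property `A` removes `k`. -/
theorem hammingDist_foldl_le (f f' : (Fin n → Bool) → (Fin n → Bool)) (A B : (Fin n → Bool) → Bool)
    (k l : ℕ) (gs : List (CGate n m)) (s s' : Fin m → Bool)
    (H : ∀ y, ∀ y' ∈ queries f' gs s', hammingDist (f y) (f' y') + (if A y then k else 0) ≤
      hammingDist y y' + (if B y then l else 0)) :
    hammingDist (gs.foldl (fun s g => g.apply f s) s) (gs.foldl (fun s g => g.apply f' s) s') +
      k * (queries f gs s).countP A ≤
    hammingDist s s' + l * (queries f gs s).countP B := by
  induction gs generalizing s s' with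
  | nil => simp [queries]
  | cons g gs ih =>
    cases g with
    | comparator i j =>
      have h1 := ih ((comparator i j).apply f s) ((comparator i j).apply f' s') H
      have h2 := hammingDist_apply_comparator f f' i j s s'
      simp only [List.foldl_cons, queries] at h1 ⊢
      omega
    | negation i =>
      have h1 := ih ((negation i).apply f s) ((negation i).apply f' s') H
      have h2 := hammingDist_apply_negation f f' i s s'
      simp only [List.foldl_cons, queries] at h1 ⊢
      omega
    | oracle src σ =>
      have h1 := ih ((oracle src σ).apply f s) ((oracle src σ).apply f' s') fun y y' hy' =>
        H y y' (List.mem_cons_of_mem _ hy')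
      have h2 := hammingDist_apply_oracle f f' src σ s s'
      have h3 := H (fun k => s (src k)) (fun k => s' (src k)) (List.mem_cons_self)
      simp only [List.foldl_cons, queries, List.countP_cons, mul_add] at h1 ⊢
      have e1 : ∀ (c : Bool) (x : ℕ), x * (if c = true then 1 else 0) =
          if c = true then x else 0 := by
        intro c x; cases c <;> simp
      rw [e1, e1]
      omega

end CGate

namespace ComparatorCircuit

variable {n : ℕ}

/-- The values of the wires at their left ends. -/
def start (C : ComparatorCircuit n) (X : Fin n → Bool) : Fin C.wires → Bool :=
  fun w => (C.annotation w).eval X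

/-- A comparator circuit that computes the iteration of length `T` has at least `2 ^ (T - 1)`
gates: at least twice as many queries enter the region `near s` as enter `near (s + 1)`. -/
theorem two_pow_le_of_foolingChain {b T W : ℕ} {X : Fin n → Bool} (C : ComparatorCircuit n)
    (hT : 1 ≤ T) (hW : 1 ≤ W)
    (A : FoolingChain n b T W (6 * W) X fun f => (CGate.queries f C.gates (C.start X)).toFinset)
    (hne : C.eval (A.F T) X ≠ C.eval (A.F (T - 1)) X) : 2 ^ (T - 1) ≤ C.gates.length := by
  classical
  let N : ℕ → ℕ := fun s =>
    (CGate.queries (A.F T) C.gates (C.start X)).countP fun y => decide (A.near s y)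
  have hfar : ∀ s < T, ∀ j < s, ∀ y' ∈ CGate.queries (A.F j) C.gates (C.start X), ∀ y,
      A.near s y → 6 * W ≤ hammingDist y y' := by
    intro s hs j hj y' hy' y hy
    rw [hammingDist_comm]
    exact A.far s hs j hj y' (List.mem_toFinset.2 hy') y hy
  have hdist : ∀ j ≤ T, ∀ y y', hammingDist (A.F T y) (A.F j y') ≤ 2 * W := by
    intro j hj y y'
    have h1 := A.bounded T le_rfl y
    have h2 := A.bounded j hj y'
    have h3 := hammingDist_triangle (A.F T y) (zeroString n) (A.F j y')
    rw [hammingDist_comm (zeroString n)] at h3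
    omega
  have hlip : ∀ j ≤ T, ∀ y y', A.F T y = A.F j y →
      hammingDist (A.F T y) (A.F j y') ≤ hammingDist y y' := by
    intro j hj y y' h
    rw [h]
    exact hammingDist_map_le (A.strict j hj) y y'
  have hdouble : ∀ s, s + 1 < T → 2 * N (s + 1) ≤ N s := by
    intro s hs
    have h := CGate.hammingDist_foldl_le (A.F T) (A.F s) (fun y => decide (A.near (s + 1) y))
      (fun y => decide (A.near s y)) (4 * W) (2 * W) C.gates (C.start X) (C.start X) ?_
    · rw [hammingDist_self] at h
      have h' : (4 * W) * N (s + 1) ≤ (2 * W) * N s := by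
        simp only [N]
        omega
      refine Nat.le_of_mul_le_mul_left (c := 2 * W) ?_ (by omega)
      linarith
    · intro y y' hy'
      have h2 := hdist s (by omega) y y'
      by_cases h1 : A.near (s + 1) y
      · have h3 := hfar (s + 1) hs s (by omega) y' hy' y h1
        simp only [h1, decide_true, if_true]
        omega
      by_cases h0 : A.near s y
      · simp only [h0, h1, decide_true, decide_false, if_true]
        simp only [Bool.false_eq_true, if_false]
        omega
      simp only [h0, h1, decide_false, Bool.false_eq_true, if_false, add_zero]
      by_cases hlater : ∃ i, s < i ∧ i < T ∧ A.near i y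
      · obtain ⟨i, hi, hiT, hnear⟩ := hlater
        have h3 := hfar i hiT s hi y' hy' y hnear
        omega
      · refine hlip s (by omega) y y' (A.eq_off T le_rfl s (by omega) y ?_)
        intro i hi hiT hnear
        rcases Nat.eq_or_lt_of_le hi with rfl | h
        · exact h0 hnear
        · exact hlater ⟨i, h, hiT, hnear⟩
  have hlast : 1 ≤ N (T - 1) := by
    by_contra! h0
    have h := CGate.hammingDist_foldl_le (A.F T) (A.F (T - 1)) (fun _ => false)
      (fun y => decide (A.near (T - 1) y)) 0 (2 * W) C.gates (C.start X) (C.start X) ?_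
    · have h0' : N (T - 1) = 0 := by omega
      simp only [N] at h0'
      rw [h0', hammingDist_self] at h
      have h' := hammingDist_eq_zero.1 (Nat.le_zero.1 ((Nat.le_add_right _ _).trans h))
      exact hne (congrFun h' C.output)
    · intro y y' hy'
      simp only [Bool.false_eq_true, if_false, add_zero]
      by_cases hy : A.near (T - 1) y
      · have h2 := hdist (T - 1) (by omega) y y'
        simp only [hy, decide_true, if_true]
        omega
      · simp only [hy, decide_false, Bool.false_eq_true, if_false, add_zero]
        refine hlip (T - 1) (by omega) y y' (A.eq_off T le_rfl (T - 1) (by omega) y ?_)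
        intro i hi hiT
        obtain rfl : i = T - 1 := by omega
        exact hy
  have hpow : ∀ k < T, 2 ^ k ≤ N (T - 1 - k) := by
    intro k
    induction k with
    | zero => intro _; simpa using hlast
    | succ k ih =>
      intro hk
      have h1 := ih (by omega)
      have h2 := hdouble (T - 1 - (k + 1)) (by omega)
      rw [show T - 1 - (k + 1) + 1 = T - 1 - k by omega] at h2
      rw [pow_succ]
      omega
  exact (hpow (T - 1) (by omega)).trans (List.countP_le_length.trans
    (CGate.length_queries_le _ _ _))

end ComparatorCircuit

/-! ### Definability in uniform `AC⁰` -/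

/-- Functions given by polynomials with natural coefficients. -/
def PolyFun {k : ℕ} (t : (Fin k → ℕ) → ℕ) : Prop :=
  ∃ p : MvPolynomial (Fin k) ℕ, ∀ v, MvPolynomial.eval v p = t v

namespace PolyFun

variable {k : ℕ} {s t : (Fin k → ℕ) → ℕ}

theorem var (i : Fin k) : PolyFun fun v => v i := ⟨MvPolynomial.X i, by simp⟩

theorem const (c : ℕ) : PolyFun fun _ : Fin k → ℕ => c := ⟨MvPolynomial.C c, by simp⟩

theorem add (hs : PolyFun s) (ht : PolyFun t) : PolyFun fun v => s v + t v := by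
  obtain ⟨p, hp⟩ := hs
  obtain ⟨q, hq⟩ := ht
  exact ⟨p + q, by simp [hp, hq]⟩

theorem mul (hs : PolyFun s) (ht : PolyFun t) : PolyFun fun v => s v * t v := by
  obtain ⟨p, hp⟩ := hs
  obtain ⟨q, hq⟩ := ht
  exact ⟨p * q, by simp [hp, hq]⟩

end PolyFun

namespace AC0Definable

variable {k : ℕ} {R S : (Fin k → ℕ) → Prop} {s t : (Fin k → ℕ) → ℕ}

theorem congr (h : AC0Definable R) (hRS : ∀ v, S v ↔ R v) : AC0Definable S := by
  rwa [show S = R from funext fun v => propext (hRS v)]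

theorem of_eq (hs : PolyFun s) (ht : PolyFun t) : AC0Definable fun v => s v = t v := by
  obtain ⟨p, hp⟩ := hs
  obtain ⟨q, hq⟩ := ht
  exact (AC0Definable.eq p q).congr (by simp [hp, hq])

theorem of_le (hs : PolyFun s) (ht : PolyFun t) : AC0Definable fun v => s v ≤ t v := by
  obtain ⟨p, hp⟩ := hs
  obtain ⟨q, hq⟩ := ht
  exact (AC0Definable.le p q).congr (by simp [hp, hq])

theorem of_lt (hs : PolyFun s) (ht : PolyFun t) : AC0Definable fun v => s v < t v :=
  of_le (hs.add (PolyFun.const 1)) ht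

theorem of_testBit (hs : PolyFun s) (ht : PolyFun t) :
    AC0Definable fun v => (s v).testBit (t v) = true := by
  obtain ⟨p, hp⟩ := hs
  obtain ⟨q, hq⟩ := ht
  exact (AC0Definable.bit p q).congr (by simp [hp, hq])

theorem or (hR : AC0Definable R) (hS : AC0Definable S) : AC0Definable fun v => R v ∨ S v :=
  (hR.not.and hS.not).not.congr fun v => by tauto

theorem ex {R : (Fin (k + 1) → ℕ) → Prop} (ht : PolyFun t) (hR : AC0Definable R) :
    AC0Definable fun v => ∃ x ≤ t v, R (Fin.cons x v) := by
  obtain ⟨p, hp⟩ := ht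
  exact (hR.exBounded p).congr (by simp [hp])

end AC0Definable

/-! ### The iterated oracle and its uniform circuits -/

/-- The relation "the first bit of `stretchIter b (α n) X (T n)` is one". -/
def iterRelation (b : ℕ) (T : ℕ → ℕ) : OracleRelation := fun n X α =>
  ∃ i : Fin n, (i : ℕ) = 0 ∧ stretchIter b (α n) X (T n) i = true

theorem stretch_one {n : ℕ} (v : Fin n → Bool) : stretch 1 v = v := by
  ext j
  simp [stretch]

/-- The comparator circuit that applies the oracle `T` times to its input. The additional constant
wire makes sure that there is an output wire when `n = 0`. -/
def iterComparator (n T : ℕ) : ComparatorCircuit n where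
  wires := n + 1
  annotation w := if h : (w : ℕ) < n then .pos ⟨w, h⟩ else .const false
  gates := List.replicate T (.oracle Fin.castSuccEmb (Equiv.refl _))
  output := 0

theorem iterComparator_foldl {n : ℕ} (f : (Fin n → Bool) → (Fin n → Bool)) (X : Fin n → Bool)
    (T : ℕ) : (iterComparator n T).gates.foldl (fun s g => g.apply f s)
      ((iterComparator n T).start X) =
        Fin.snoc (α := fun _ => Bool) (stretchIter 1 f X T) false := by
  unfold iterComparator ComparatorCircuit.start
  induction T with
  | zero =>
    ext w
    refine Fin.lastCases ?_ (fun w => ?_) w <;> simp [stretchIter, Annotation.eval]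
  | succ T ih =>
    rw [List.replicate_succ', List.foldl_append]
    simp only at ih ⊢
    rw [ih, List.foldl_cons, List.foldl_nil, stretchIter, stretch_one, CGate.apply]
    ext w
    refine Fin.lastCases ?_ (fun w => ?_) w
    · rw [Function.extend_apply']
      · simp
      · rintro ⟨k, hk⟩
        exact (Fin.castSucc_lt_last k).ne hk
    · have hinj : Function.Injective fun j : Fin n =>
          Fin.castSuccEmb (Equiv.refl (Fin n) j) := fun a b h => by simpa using h
      have := hinj.extend_apply (f fun j => Fin.snoc (α := fun _ => Bool) (stretchIter 1 f X T)
        false (Fin.castSuccEmb j)) (Fin.snoc (α := fun _ => Bool) (stretchIter 1 f X T) false) w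
      simp only [Equiv.refl_apply, Fin.coe_castSuccEmb] at this ⊢
      rw [this]
      simp

theorem iterComparator_computes (T : ℕ → ℕ) :
    ComparatorComputes Set.univ (fun n => iterComparator n (T n)) (iterRelation 1 T) := by
  intro n X α _
  change (List.foldl (fun s g => g.apply (α n) s) ((iterComparator n (T n)).start X)
    (iterComparator n (T n)).gates) (0 : Fin (n + 1)) = true ↔ _
  rw [iterComparator_foldl]
  rcases n with _ | n
  · simp [iterRelation, Fin.snoc]
  · rw [← Fin.castSucc_zero, Fin.snoc_castSucc]
    constructor
    · exact fun h => ⟨0, rfl, h⟩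
    · rintro ⟨i, hi, h⟩
      rwa [show i = 0 from Fin.ext hi] at h

theorem iterComparator_table (n T i j x : ℕ) :
    (∃ row, (iterComparator n T).table[i]? = some row ∧ row[j]? = some x) ↔
      (i < n ∧ (j = 0 ∧ x = 1 ∨ j = 1 ∧ x = i)) ∨ (i = n ∧ j < 2 ∧ x = 0) ∨
      (n < i ∧ i < n + 1 + T ∧ (j = 0 ∧ x = 5 ∨ (0 < j ∧ j < n + 1 ∧ x + 1 = j) ∨
        (n < j ∧ j < 2 * n + 1 ∧ x + n + 1 = j))) ∨
      (i = n + 1 + T ∧ (j = 0 ∧ x = 6 ∨ j = 1 ∧ x = 0)) := by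
  have hpair : ∀ a c : ℕ, [a, c][j]? = some x ↔ (j = 0 ∧ x = a ∨ j = 1 ∧ x = c) := by
    intro a c
    rcases j with _ | _ | j <;> simp [eq_comm]
  have horacle : (CGate.oracle (n := n) Fin.castSuccEmb (Equiv.refl _)).row[j]? = some x ↔
      (j = 0 ∧ x = 5 ∨ (0 < j ∧ j < n + 1 ∧ x + 1 = j) ∨
        (n < j ∧ j < 2 * n + 1 ∧ x + n + 1 = j)) := by
    rcases j with _ | j
    · simp [CGate.row, eq_comm]
    · simp only [CGate.row, List.cons_append, List.getElem?_cons_succ, List.getElem?_append,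
        List.length_ofFn, List.getElem?_ofFn]
      split_ifs <;> simp <;> omega
  have hrow : (iterComparator n T).table[i]? =
      if i < n then some [1, i] else if i = n then some [0, 0] else
      if i < n + 1 + T then some (CGate.oracle (n := n) Fin.castSuccEmb (Equiv.refl _)).row else
      if i = n + 1 + T then some [6, 0] else none := by
    have htable : (iterComparator n T).table =
        (List.ofFn fun w : Fin (n + 1) => if (w : ℕ) < n then [1, (w : ℕ)] else [0, 0]) ++
        (List.replicate T (CGate.oracle (n := n) Fin.castSuccEmb (Equiv.refl _)).row ++
          [[6, 0]]) := by
      simp only [ComparatorCircuit.table, iterComparator, List.append_assoc, List.map_replicate]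
      congr 2
      ext1 w
      split_ifs <;> rfl
    rw [htable, List.getElem?_append, List.length_ofFn, List.getElem?_ofFn]
    by_cases h1 : i < n + 1
    · rw [if_pos h1, dif_pos h1]
      by_cases h2 : i < n
      · simp [h2]
      · simp [show i = n by omega]
    · rw [if_neg h1, if_neg (by omega), if_neg (by omega), List.getElem?_append,
        List.length_replicate, List.getElem?_replicate]
      by_cases h3 : i < n + 1 + T
      · rw [if_pos (by omega), if_pos (by omega), if_pos h3]
      · rw [if_neg (by omega), if_neg h3]
        by_cases h4 : i = n + 1 + T
        · simp [h4]
        · rw [if_neg h4, List.getElem?_eq_none]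
          simp only [List.length_singleton]
          omega
  rw [hrow]
  split_ifs with h1 h2 h3 h4
  · simp [hpair, h1, h1.ne, h1.not_gt, show i ≠ n + 1 + T by omega]
  · have : n ≠ n + 1 + T := by omega
    simp only [Option.some.injEq, exists_eq_left', hpair, h2, lt_irrefl, this, false_and, true_and,
      false_or, or_false]
    omega
  · simp only [Option.some.injEq, exists_eq_left', horacle, h1, h2, h3, h3.ne,
      show n < i by omega, false_and, true_and, false_or, or_false]
  · simp only [Option.some.injEq, exists_eq_left', hpair, h1, h2, h3, eq_true h4, false_and,
      and_false, true_and, false_or]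
  · simp only [false_and, exists_false, h1, h2, h3, h4, and_false, or_false]

/-- The integral part of the fourth root. -/
def fourthRoot (n : ℕ) : ℕ := Nat.sqrt (Nat.sqrt n)

theorem fourthRoot_le (n : ℕ) : fourthRoot n ≤ n := (Nat.sqrt_le_self _).trans (Nat.sqrt_le_self _)

theorem eq_fourthRoot_iff (t n : ℕ) :
    t = fourthRoot n ↔ t * t * (t * t) ≤ n ∧ n < (t + 1) * (t + 1) * ((t + 1) * (t + 1)) := by
  rw [fourthRoot, Nat.eq_sqrt, Nat.le_sqrt, Nat.sqrt_lt]

theorem iterComparator_uniform : AC0Uniform fun n => (iterComparator n (fourthRoot n)).table := by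
  refine (AC0Definable.ex (k := 4) (t := fun v => v 0) (R := fun w =>
      ((w 0 * w 0 * (w 0 * w 0) ≤ w 1 ∧ w 1 < (w 0 + 1) * (w 0 + 1) * ((w 0 + 1) * (w 0 + 1))) ∧
      ((w 2 < w 1 ∧ (w 3 = 0 ∧ w 4 = 1 ∨ w 3 = 1 ∧ w 4 = w 2)) ∨
        (w 2 = w 1 ∧ w 3 < 2 ∧ w 4 = 0) ∨
      (w 1 < w 2 ∧ w 2 < w 1 + 1 + w 0 ∧ (w 3 = 0 ∧ w 4 = 5 ∨
        (0 < w 3 ∧ w 3 < w 1 + 1 ∧ w 4 + 1 = w 3) ∨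
        (w 1 < w 3 ∧ w 3 < 2 * w 1 + 1 ∧ w 4 + w 1 + 1 = w 3))) ∨
      (w 2 = w 1 + 1 + w 0 ∧ (w 3 = 0 ∧ w 4 = 6 ∨ w 3 = 1 ∧ w 4 = 0)))))
    (PolyFun.var 0) ?_).congr ?_
  · repeat' first
      | apply AC0Definable.and
      | apply AC0Definable.or
      | apply AC0Definable.of_eq
      | apply AC0Definable.of_lt
      | apply AC0Definable.of_le
      | exact PolyFun.var _
      | exact PolyFun.const _
      | apply PolyFun.add
      | apply PolyFun.mul
  · intro v
    rw [iterComparator_table]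
    constructor
    · intro h
      exact ⟨fourthRoot (v 0), fourthRoot_le _, (eq_fourthRoot_iff _ _).1 rfl, h⟩
    · rintro ⟨t, -, ht, h⟩
      have := (eq_fourthRoot_iff t (v 0)).2 ht
      subst this
      exact h

theorem iterRelation_inUniformCC : InUniformCC Set.univ (iterRelation 1 fourthRoot) := by
  refine ⟨fun n => iterComparator n (fourthRoot n), ⟨2 * Polynomial.X + 1, fun n => ?_⟩,
    iterComparator_uniform, iterComparator_computes _⟩
  have := fourthRoot_le n
  simp [ComparatorCircuit.size, iterComparator]
  omega

/-- The number of values after `i` oracle gates. -/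
def iterWidth (n : ℕ) : ℕ → ℕ
  | 0 => n
  | i + 1 => iterWidth n i + n

theorem iterWidth_eq (n i : ℕ) : iterWidth n i = n * (i + 1) := by
  induction i with
  | zero => simp [iterWidth]
  | succ i ih => rw [iterWidth, ih]; ring

theorem iterSource_lt {n : ℕ} (i b : ℕ) (j : Fin n) : n * i + j / b < iterWidth n i := by
  rw [iterWidth_eq, mul_add, mul_one]
  exact Nat.add_lt_add_left ((Nat.div_le_self _ _).trans_lt j.2) _

/-- A chain of oracle gates, each of which reads the stretched output of the one before. -/
def iterGates (n b : ℕ) : (i : ℕ) → Gates n (iterWidth n i)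
  | 0 => .inputs
  | i + 1 => .oracle (iterGates n b i) fun j => ⟨n * i + j / b, iterSource_lt i b j⟩

theorem iterGates_rows (n b i : ℕ) : (iterGates n b i).rows =
    (List.range i).map fun k => 4 :: List.ofFn fun j : Fin n => n * k + j / b := by
  induction i with
  | zero => rfl
  | succ i ih =>
    rw [List.range_succ, List.map_append, ← ih]
    rfl

theorem iterGates_eval {n : ℕ} (b : ℕ) (f : (Fin n → Bool) → (Fin n → Bool)) (X : Fin n → Bool)
    (i : ℕ) (j : Fin n) (w : Fin (iterWidth n i)) (hw : (w : ℕ) = n * i + j) :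
    (iterGates n b i).eval f X w = stretchIter b f X i j := by
  induction i generalizing j with
  | zero =>
    obtain rfl : w = j := Fin.ext (by simpa using hw)
    rfl
  | succ i ih =>
    have : w = Fin.natAdd (iterWidth n i) j := by
      ext
      rw [hw, Fin.val_natAdd, iterWidth_eq]
    rw [this]
    refine (Fin.append_right ((iterGates n b i).eval f X) _ j).trans ?_
    rw [stretchIter]
    congr 2
    ext k
    exact ih ⟨k / b, (Nat.div_le_self _ _).trans_lt k.2⟩ _ rfl

theorem iterGates_depth_le (n b i : ℕ) (w : Fin (iterWidth n i)) :
    (iterGates n b i).depth w ≤ i := by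
  induction i with
  | zero => exact le_rfl
  | succ i ih =>
    refine Fin.addCases (fun w => ?_) (fun w => ?_) w
    · exact (Fin.append_left (iterGates n b i).depth _ w).trans_le ((ih w).trans (Nat.le_succ i))
    · refine (Fin.append_right (iterGates n b i).depth _ w).trans_le (Nat.succ_le_succ ?_)
      exact Finset.sup_le fun k _ => ih _

theorem iterGates_oracleDepth_le (n b i : ℕ) (w : Fin (iterWidth n i)) :
    (iterGates n b i).oracleDepth w ≤ i := by
  induction i with
  | zero => exact le_rfl
  | succ i ih =>
    refine Fin.addCases (fun w => ?_) (fun w => ?_) w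
    · exact (Fin.append_left (iterGates n b i).oracleDepth _ w).trans_le
        ((ih w).trans (Nat.le_succ i))
    · refine (Fin.append_right (iterGates n b i).oracleDepth _ w).trans_le (Nat.succ_le_succ ?_)
      exact Finset.sup_le fun k _ => ih _

/-- The Boolean circuit that iterates the oracle `T` times and stretches its argument by the factor
`b` each time. The constant gate makes sure that there is an output when `n = 0`. -/
def iterBoolean (n b T : ℕ) : BooleanCircuit n where
  values := iterWidth n T + 1
  gates := .const (iterGates n b T) false
  output := ⟨n * T, by
    rw [iterWidth_eq]
    exact Nat.lt_succ_of_le (Nat.mul_le_mul_left n (Nat.le_succ T))⟩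

theorem iterBoolean_computes (b : ℕ) (T : ℕ → ℕ) :
    BooleanComputes Set.univ (fun n => iterBoolean n b (T n)) (iterRelation b T) := by
  intro n X α _
  change Fin.snoc (α := fun _ => Bool) ((iterGates n b (T n)).eval (α n) X) false
    ⟨n * T n, _⟩ = true ↔ _
  rcases n with _ | n
  · have : (⟨0 * T 0, by simp⟩ : Fin (iterWidth 0 (T 0) + 1)) = Fin.last _ := by
      ext
      simp [iterWidth_eq]
    rw [this, Fin.snoc_last]
    simp [iterRelation]
  · have hlt : (n + 1) * T (n + 1) < iterWidth (n + 1) (T (n + 1)) := by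
      rw [iterWidth_eq]
      exact Nat.mul_lt_mul_of_pos_left (Nat.lt_succ_self _) (Nat.succ_pos n)
    have h := iterGates_eval b (α (n + 1)) X (T (n + 1)) 0 ⟨_, hlt⟩ (by simp)
    have h' : ∀ (y : Fin (iterWidth (n + 1) (T (n + 1))) → Bool) (p),
        Fin.snoc (α := fun _ => Bool) y false ⟨(n + 1) * T (n + 1), p⟩ = y ⟨_, hlt⟩ := fun y p =>
      Fin.snoc_castSucc (α := fun _ => Bool) false y ⟨_, hlt⟩
    rw [h', h]
    constructor
    · exact fun h => ⟨0, rfl, h⟩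
    · rintro ⟨i, hi, h⟩
      rwa [show i = 0 from Fin.ext hi] at h

theorem iterBoolean_table {b : ℕ} (hb : 0 < b) (n T i j x : ℕ) :
    (∃ row, (iterBoolean n b T).table[i]? = some row ∧ row[j]? = some x) ↔
      (i < T ∧ (j = 0 ∧ x = 4 ∨ (0 < j ∧ j < n + 1 ∧ b * x < b * (n * i) + j ∧
        b * (n * i) + j ≤ b * x + b))) ∨ (i = T ∧ j < 2 ∧ x = 0) ∨
      (i = T + 1 ∧ (j = 0 ∧ x = 5 ∨ j = 1 ∧ x = n * T)) := by
  have hpair : ∀ a c : ℕ, [a, c][j]? = some x ↔ (j = 0 ∧ x = a ∨ j = 1 ∧ x = c) := by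
    intro a c
    rcases j with _ | _ | j <;> simp [eq_comm]
  have horacle : (4 :: List.ofFn fun k : Fin n => n * i + k / b)[j]? = some x ↔
      (j = 0 ∧ x = 4 ∨ (0 < j ∧ j < n + 1 ∧ b * x < b * (n * i) + j ∧
        b * (n * i) + j ≤ b * x + b)) := by
    rcases j with _ | j
    · simp [eq_comm]
    · simp only [List.getElem?_cons_succ, List.getElem?_ofFn]
      have hx : n * i + j / b = x ↔
          b * x < b * (n * i) + (j + 1) ∧ b * (n * i) + (j + 1) ≤ b * x + b := by
        have h1 : n * i + j / b = (b * (n * i) + j) / b := (Nat.mul_add_div hb _ _).symm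
        rw [h1, Nat.div_eq_iff hb, mul_comm x b]
        omega
      split_ifs with h
      · simp [hx, h]
      · simp [h]
  have hrow : (iterBoolean n b T).table[i]? =
      if i < T then some (4 :: List.ofFn fun k : Fin n => n * i + k / b) else
      if i = T then some [0, 0] else if i = T + 1 then some [5, n * T] else none := by
    have htable : (iterBoolean n b T).table =
        ((List.range T).map fun k => 4 :: List.ofFn fun j : Fin n => n * k + j / b) ++
          [[0, 0], [5, n * T]] := by
      rw [← iterGates_rows, BooleanCircuit.table, iterBoolean, Gates.rows, List.append_assoc]
      rfl
    rw [htable, List.getElem?_append, List.length_map, List.length_range, List.getElem?_map]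
    split_ifs with h1 h2 h3
    · simp [h1]
    · simp [h2]
    · simp [h3]
    · obtain ⟨k, rfl⟩ : ∃ k, i = T + k + 2 := ⟨i - T - 2, by omega⟩
      rw [show T + k + 2 - T = k + 2 by omega]
      simp
  rw [hrow]
  split_ifs with h1 h2 h3
  · simp only [Option.some.injEq, exists_eq_left', horacle]; omega
  · simp [hpair]; omega
  · simp [hpair]; omega
  · simp; omega

theorem eq_log_iff (a n : ℕ) : a = Nat.log 2 n ↔
    (n = 0 ∧ a = 0) ∨ (n.testBit a = true ∧ ¬ ∃ y ≤ n, a < y ∧ n.testBit y = true) := by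
  rcases Nat.eq_zero_or_pos n with rfl | hn
  · simp
  rw [eq_comm, Nat.log_eq_iff (Or.inr ⟨by norm_num, hn.ne'⟩)]
  constructor
  · rintro ⟨h1, h2⟩
    have hhigh : ∀ y, a < y → n.testBit y = false := fun y hy =>
      Nat.testBit_lt_two_pow (h2.trans_le (Nat.pow_le_pow_right (by norm_num) hy))
    refine Or.inr ⟨?_, ?_⟩
    · by_contra hbit
      refine absurd h1 (not_le.2 (Nat.lt_pow_two_of_testBit n fun y hy => ?_))
      rcases Nat.eq_or_lt_of_le hy with rfl | h
      · simpa using hbit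
      · exact hhigh y h
    · rintro ⟨y, -, hy, h⟩
      rw [hhigh y hy] at h
      exact absurd h (by simp)
  · rintro (⟨h, -⟩ | ⟨h1, h2⟩)
    · omega
    · refine ⟨Nat.ge_two_pow_of_testBit h1, Nat.lt_pow_two_of_testBit n fun y hy => ?_⟩
      by_contra hbit
      have hbit' : n.testBit y = true := by simpa using hbit
      have := Nat.ge_two_pow_of_testBit hbit'
      exact h2 ⟨y, (Nat.lt_two_pow_self.le).trans this, hy, hbit'⟩

/-- The square of the binary logarithm. -/
def logSq (n : ℕ) : ℕ := Nat.log 2 n * Nat.log 2 n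

theorem iterBoolean_uniform {b : ℕ} (hb : 0 < b) :
    AC0Uniform fun n => (iterBoolean n b (logSq n)).table := by
  have hlog : AC0Definable (k := 5) fun w =>
      (w 1 = 0 ∧ w 0 = 0) ∨ ((w 1).testBit (w 0) = true ∧
        ¬ ∃ y ≤ w 1, w 0 < y ∧ (w 1).testBit y = true) := by
    refine ((AC0Definable.of_eq (PolyFun.var _) (PolyFun.const _)).and
      (AC0Definable.of_eq (PolyFun.var _) (PolyFun.const _))).or
      ((AC0Definable.of_testBit (PolyFun.var _) (PolyFun.var _)).and
        (AC0Definable.ex (R := fun u => u 1 < u 0 ∧ (u 2).testBit (u 0) = true) (PolyFun.var 1)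
          ((AC0Definable.of_lt (PolyFun.var _) (PolyFun.var _)).and
            (AC0Definable.of_testBit (PolyFun.var _) (PolyFun.var _)))).not)
  refine (AC0Definable.ex (k := 4) (t := fun v => v 0) (PolyFun.var 0) (hlog.and
    (S := fun w =>
      (w 2 < w 0 * w 0 ∧ (w 3 = 0 ∧ w 4 = 4 ∨ (0 < w 3 ∧ w 3 < w 1 + 1 ∧
        b * w 4 < b * (w 1 * w 2) + w 3 ∧ b * (w 1 * w 2) + w 3 ≤ b * w 4 + b))) ∨
      (w 2 = w 0 * w 0 ∧ w 3 < 2 ∧ w 4 = 0) ∨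
      (w 2 = w 0 * w 0 + 1 ∧ (w 3 = 0 ∧ w 4 = 5 ∨ w 3 = 1 ∧ w 4 = w 1 * (w 0 * w 0)))) ?_)).congr ?_
  · repeat' first
      | apply AC0Definable.and
      | apply AC0Definable.or
      | apply AC0Definable.of_eq
      | apply AC0Definable.of_lt
      | apply AC0Definable.of_le
      | exact PolyFun.var _
      | exact PolyFun.const _
      | apply PolyFun.add
      | apply PolyFun.mul
  · intro v
    rw [iterBoolean_table hb]
    constructor
    · intro h
      exact ⟨Nat.log 2 (v 0), Nat.log_le_self _ _, (eq_log_iff _ _).1 rfl, h⟩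
    · rintro ⟨a, -, ha, h⟩
      have := (eq_log_iff a (v 0)).2 ha
      subst this
      exact h

theorem logSq_le (n : ℕ) : logSq n ≤ n * n :=
  Nat.mul_le_mul (Nat.log_le_self _ _) (Nat.log_le_self _ _)

theorem iterRelation_inUniformNC {b : ℕ} (hb : 0 < b) :
    InUniformNC 3 Set.univ (iterRelation b logSq) := by
  refine ⟨fun n => iterBoolean n b (logSq n), ⟨⟨Polynomial.X * Polynomial.X + 1, fun n => ?_⟩,
    ⟨1, fun n => ?_⟩, ⟨1, fun n => ?_⟩⟩, iterBoolean_uniform hb, iterBoolean_computes b logSq⟩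
  · have := logSq_le n
    simpa [BooleanCircuit.size, iterBoolean, Gates.rows, iterGates_rows] using this
  · refine Finset.sup_le fun w _ => ?_
    have h1 : logSq n ≤ Nat.log 2 n ^ 3 := by
      rw [logSq, ← sq]
      rcases Nat.eq_zero_or_pos (Nat.log 2 n) with h | h
      · simp [h]
      · exact Nat.pow_le_pow_right h (by norm_num)
    refine Fin.lastCases ?_ (fun w => ?_) w
    · simp [iterBoolean, Gates.depth]
    · have h2 := iterGates_depth_le n b (logSq n) w
      simp only [iterBoolean, Gates.depth, Fin.snoc_castSucc]
      omega
  · refine Finset.sup_le fun w _ => ?_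
    have h1 : logSq n = Nat.log 2 n ^ (3 - 1) := by rw [logSq, ← sq]
    refine Fin.lastCases ?_ (fun w => ?_) w
    · simp [iterBoolean, Gates.oracleDepth]
    · have h2 := iterGates_oracleDepth_le n b (logSq n) w
      simp only [iterBoolean, Gates.oracleDepth, Fin.snoc_castSucc]
      omega

/-! ### Growth rates and the choice of parameters -/

theorem exists_eval_lt_pow (p : Polynomial ℕ) : ∃ e N : ℕ, ∀ n ≥ N, p.eval n + 1 ≤ n ^ e := by
  refine ⟨p.natDegree + 1, p.eval 1 + 1, fun n hn => ?_⟩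
  have h1 : p.eval n ≤ p.eval 1 * n ^ p.natDegree := by
    rw [Polynomial.eval_eq_sum_range, Polynomial.eval_eq_sum_range, Finset.sum_mul]
    refine Finset.sum_le_sum fun i hi => ?_
    rw [one_pow, mul_one]
    refine Nat.mul_le_mul_left _ (Nat.pow_le_pow_right (by omega) ?_)
    exact Nat.lt_succ_iff.1 (Finset.mem_range.1 hi)
  have h2 : 1 ≤ n ^ p.natDegree := Nat.one_le_pow _ _ (by omega)
  calc p.eval n + 1 ≤ (p.eval 1 + 1) * n ^ p.natDegree := by rw [add_mul, one_mul]; omega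
    _ ≤ n * n ^ p.natDegree := Nat.mul_le_mul_right _ hn
    _ = n ^ (p.natDegree + 1) := by rw [pow_succ']

theorem le_fourthRoot {S n : ℕ} (h : S * S * (S * S) ≤ n) : S ≤ fourthRoot n :=
  Nat.le_sqrt.2 (Nat.le_sqrt.2 h)

theorem exists_polylog_lt_fourthRoot (k c : ℕ) :
    ∃ N : ℕ, ∀ n ≥ N, c * Nat.log 2 n ^ k + c < fourthRoot n := by
  have h := (tendsto_pow_const_div_const_pow_of_one_lt (k + 1) (one_lt_two (α := ℝ))).eventually
    (gt_mem_nhds one_pos)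
  obtain ⟨M, hM⟩ := Filter.eventually_atTop.1 h
  let M' := max M (2 * c * 8 ^ k + 1)
  refine ⟨2 ^ (4 * M'), fun n hn => ?_⟩
  have hn0 : n ≠ 0 := by
    have : 0 < 2 ^ (4 * M') := by positivity
    omega
  set m := Nat.log 2 n / 4 with hm
  have hmM : M' ≤ m := by
    have := Nat.le_log_of_pow_le one_lt_two hn
    omega
  have hm1 : 2 * c * 8 ^ k + 1 ≤ m := (le_max_right _ _).trans hmM
  have h1 : m ^ (k + 1) < 2 ^ m := by
    have := hM m ((le_max_left _ _).trans hmM)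
    rw [div_lt_one (by positivity)] at this
    exact_mod_cast this
  have h2 : 2 ^ m ≤ fourthRoot n := by
    refine le_fourthRoot ?_
    calc 2 ^ m * 2 ^ m * (2 ^ m * 2 ^ m) = 2 ^ (4 * m) := by ring
      _ ≤ 2 ^ Nat.log 2 n := Nat.pow_le_pow_right (by norm_num) (by omega)
      _ ≤ n := Nat.pow_log_le_self 2 hn0
  have h3 : Nat.log 2 n ≤ 8 * m := by omega
  have h4 : 1 ≤ (8 * m) ^ k := Nat.one_le_pow _ _ (by omega)
  refine lt_of_le_of_lt ?_ (h1.trans_le h2)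
  calc c * Nat.log 2 n ^ k + c ≤ c * (8 * m) ^ k + c * (8 * m) ^ k :=
        Nat.add_le_add (Nat.mul_le_mul_left _ (Nat.pow_le_pow_left h3 k))
          (Nat.le_mul_of_pos_right _ h4)
    _ = (2 * c * 8 ^ k) * m ^ k := by rw [mul_pow]; ring
    _ ≤ m * m ^ k := Nat.mul_le_mul_right _ (by omega)
    _ = m ^ (k + 1) := by rw [pow_succ']

/-- For long enough inputs there is a code that meets the requirements of `exists_foolingChain`
for polynomially many queries. -/
theorem exists_code_parameters (b e : ℕ) : ∃ N : ℕ, ∀ n ≥ N, ∃ P : ℕ, P.Prime ∧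
    b * (2 + P * P) ≤ n ∧ codeLength (4 * e + 1) (fourthRoot n) 0 ≤ P ∧
    fourthRoot n * n ^ e < P ^ (4 * e + 1) := by
  set K := 4 * (4 * e + 1 + 3) with hK
  let S := 18 * b * K ^ 2 + 1
  refine ⟨S * S * (S * S), fun n hn => ?_⟩
  set s := fourthRoot n with hs
  have hS : S ≤ s := le_fourthRoot hn
  obtain ⟨hs1, hs2⟩ := (eq_fourthRoot_iff s n).1 rfl
  obtain ⟨P, hP, hP1, hP2⟩ := Nat.exists_prime_lt_and_le_two_mul (K * (s + 1)) (by positivity)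
  have hsP : s + 1 ≤ P := (Nat.le_mul_of_pos_left _ (by omega)).trans hP1.le
  refine ⟨P, hP, ?_, ?_, ?_⟩
  · have h1 : P ≤ 4 * K * s := by
      refine hP2.trans ?_
      have : s + 1 ≤ 2 * s := by omega
      calc 2 * (K * (s + 1)) ≤ 2 * (K * (2 * s)) := by gcongr
        _ = 4 * K * s := by ring
    have h2 : 1 ≤ K ^ 2 * s ^ 2 := Nat.mul_pos (by positivity) (Nat.pow_pos (by omega))
    calc b * (2 + P * P) ≤ b * (2 + (4 * K * s) * (4 * K * s)) := by gcongr
      _ = b * (2 * 1 + 16 * (K ^ 2 * s ^ 2)) := by ring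
      _ ≤ b * (2 * (K ^ 2 * s ^ 2) + 16 * (K ^ 2 * s ^ 2)) := by gcongr
      _ = 18 * b * K ^ 2 * s ^ 2 := by ring
      _ ≤ s * s ^ 2 := Nat.mul_le_mul_right _ (by omega)
      _ ≤ s * s * (s * s) := by
        rw [show s * s ^ 2 = s * s * (1 * s) by ring]
        gcongr
        omega
      _ ≤ n := hs1
  · refine le_trans (le_of_eq ?_) hP1.le
    rw [codeLength, hK]
    ring_nf
    simp
    ring
  · have h1 : n ≤ P ^ 4 := by
      refine hs2.le.trans ?_
      calc (s + 1) * (s + 1) * ((s + 1) * (s + 1)) = (s + 1) ^ 4 := by ring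
        _ ≤ P ^ 4 := Nat.pow_le_pow_left hsP 4
    have hP0 : 0 < P ^ (4 * e) := Nat.pow_pos hP.pos
    calc s * n ^ e ≤ s * (P ^ 4) ^ e := by gcongr
      _ = s * P ^ (4 * e) := by rw [pow_mul]
      _ < P * P ^ (4 * e) := Nat.mul_lt_mul_of_pos_right hsP hP0
      _ = P ^ (4 * e + 1) := by rw [pow_succ']

theorem codeLength_mono {t T T' : ℕ} (h : T ≤ T') : codeLength t T 0 ≤ codeLength t T' 0 :=
  Nat.mul_le_mul_left _ (by omega)

/-! ### The separations -/

/-- The oracle that applies `f` to strings of length `n` and is the identity elsewhere. -/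
def singleOracle (n : ℕ) (f : (Fin n → Bool) → (Fin n → Bool)) : Oracle :=
  Function.update (fun _ => id) n f

@[simp] theorem singleOracle_self (n : ℕ) (f : (Fin n → Bool) → (Fin n → Bool)) :
    singleOracle n f n = f := Function.update_self _ _ _

theorem strictlyLipschitz_singleOracle {n : ℕ} {f : (Fin n → Bool) → (Fin n → Bool)}
    (hf : ∀ x y, hammingDist x y = 1 → hammingDist (f x) (f y) = 1) :
    StrictlyLipschitz (singleOracle n f) := by
  intro m X X' h
  by_cases hm : m = n
  · subst hm
    rw [singleOracle_self]
    exact hf X X' h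
  · simpa [singleOracle, Function.update_of_ne hm] using h

/-- The last two oracles of a fooling chain are separated by the iterated relation. -/
theorem FoolingChain.not_computes {n b W gap : ℕ} {T : ℕ → ℕ} {X : Fin n → Bool}
    {Q : ((Fin n → Bool) → (Fin n → Bool)) → Finset (Fin n → Bool)}
    (A : FoolingChain n b (T n) W gap X Q) (hn : 0 < n)
    {value : ((Fin n → Bool) → (Fin n → Bool)) → Bool}
    (hvalue : ∀ α, StrictlyLipschitz α → (value (α n) = true ↔ iterRelation b T n X α)) :
    value (A.F (T n)) ≠ value (A.F (T n - 1)) := by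
  intro h
  have h1 := hvalue _ (strictlyLipschitz_singleOracle (A.strict (T n) le_rfl))
  have h2 := hvalue _ (strictlyLipschitz_singleOracle (A.strict (T n - 1) (Nat.sub_le _ _)))
  rw [singleOracle_self] at h1 h2
  have h3 : iterRelation b T n X (singleOracle n (A.F (T n))) :=
    ⟨⟨0, hn⟩, rfl, by rw [singleOracle_self]; exact A.final_true _ rfl⟩
  obtain ⟨i, hi, h4⟩ := h2.1 (h ▸ h1.2 h3)
  rw [singleOracle_self, A.final_false i hi] at h4
  exact absurd h4 (by simp)

theorem iterRelation_notInNC :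
    ¬ InNC {α | StrictlyLipschitz α} (iterRelation 1 fourthRoot) := by
  rintro ⟨k, -, C, ⟨⟨p, hp⟩, -, ⟨c, hc⟩⟩, hC⟩
  obtain ⟨e, N₁, he⟩ := exists_eval_lt_pow p
  obtain ⟨N₂, hlog⟩ := exists_polylog_lt_fourthRoot (k - 1) c
  obtain ⟨N₃, hcode⟩ := exists_code_parameters 1 e
  obtain ⟨n, hn1, hn2, hn3, hn0⟩ : ∃ n, N₁ ≤ n ∧ N₂ ≤ n ∧ N₃ ≤ n ∧ 0 < n :=
    ⟨N₁ + N₂ + N₃ + 1, by omega, by omega, by omega, by omega⟩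
  obtain ⟨P, hP, hPn, hLP, hPq⟩ := hcode n hn3
  have hdepth : (C n).oracleDepth < fourthRoot n := (hc n).trans_lt (hlog n hn2)
  have := Fact.mk hP
  obtain ⟨A⟩ := exists_foolingChain (n := n) (b := 1) (t := 4 * e + 1) (T := fourthRoot n)
    (q := p.eval n) (gap := 1) odd_one (by omega) (by omega) hPn hLP
    ((Nat.mul_le_mul_left _ (he n hn1)).trans_lt hPq)
    (by
      intro s hs
      rw [codeLength_succ hs.le]
      omega)
    (fun f => ((C n).gates.queries f (chainStart n (4 * e + 1) (fourthRoot n) P)).toFinset)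
    (fun f => (List.toFinset_card_le _).trans ((Gates.length_queries_le _ _ _).trans (hp n)))
  exact A.not_computes hn0 (value := fun f => (C n).eval f _) (fun α hα => hC n _ α hα)
    ((C n).eval_eq_of_foolingChain le_rfl A hdepth)

theorem iterRelation_notInCC :
    ¬ InCC {α | StrictlyLipschitz α} (iterRelation 29 logSq) := by
  rintro ⟨C, ⟨p, hp⟩, hC⟩
  obtain ⟨e, N₁, he⟩ := exists_eval_lt_pow p
  obtain ⟨N₂, hlog⟩ := exists_polylog_lt_fourthRoot 2 1
  obtain ⟨N₃, hcode⟩ := exists_code_parameters 29 e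
  have hpow : 1 ≤ 2 ^ (e + 2) := Nat.one_le_two_pow
  obtain ⟨n, hn1, hn2, hn3, hn4⟩ : ∃ n, N₁ ≤ n ∧ N₂ ≤ n ∧ N₃ ≤ n ∧ 2 ^ (e + 2) ≤ n :=
    ⟨N₁ + N₂ + N₃ + 2 ^ (e + 2), by omega, by omega, by omega, by omega⟩
  have hn0 : 0 < n := lt_of_lt_of_le (by positivity) hn4
  obtain ⟨P, hP, hPn, hLP, hPq⟩ := hcode n hn3
  have hL : e + 2 ≤ Nat.log 2 n := Nat.le_log_of_pow_le one_lt_two hn4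
  have hT : logSq n ≤ fourthRoot n := by
    have := hlog n hn2
    rw [sq] at this
    unfold logSq
    omega
  have hT1 : 1 ≤ logSq n := Nat.mul_pos (by omega) (by omega)
  set t := 4 * e + 1 with ht
  have := Fact.mk hP
  have hW : 8 * (t + 3) ≤ codeLength t (logSq n) 0 := by
    calc 8 * (t + 3) = 2 * (t + 3) * 4 := by ring
      _ ≤ _ := Nat.mul_le_mul_left _ (by omega)
  have hsize : (C n).gates.length + 1 ≤ n ^ e := by
    refine le_trans ?_ (he n hn1)
    have := hp n
    simp only [ComparatorCircuit.size] at this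
    omega
  obtain ⟨A⟩ := exists_foolingChain (n := n) (b := 29) (t := t) (T := logSq n)
    (q := p.eval n) (gap := 6 * codeLength t (logSq n) 0) (by decide) (by omega) hT1 hPn
    ((codeLength_mono hT).trans hLP)
    ((Nat.mul_le_mul hT (he n hn1)).trans_lt hPq)
    (by
      -- the codewords keep half of their initial length `W`, intersections take at most `W / 8`,
      -- and `7 * W ≤ 29 * (W / 2 - W / 8)`
      intro s hs
      have h1 := codeLength_succ (t := t) hs.le
      have h2 := codeLength_le t (logSq n) s
      have h3 : codeLength t (logSq n) 0 ≤ 2 * codeLength t (logSq n) s := by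
        calc codeLength t (logSq n) 0 ≤ 2 * (t + 3) * (2 * (2 * logSq n + 2 - s)) :=
              Nat.mul_le_mul_left _ (by omega)
          _ = 2 * codeLength t (logSq n) s := by rw [codeLength]; ring
      omega)
    (fun f => (CGate.queries f (C n).gates
      ((C n).start (chainStart n t (logSq n) P))).toFinset)
    (fun f => (List.toFinset_card_le _).trans ((CGate.length_queries_le _ _ _).trans (by
      have := hp n
      simp only [ComparatorCircuit.size] at this
      omega)))
  have hne := A.not_computes hn0 (value := fun f => (C n).eval f _) (fun α hα => hC n _ α hα)
  have h1 := (C n).two_pow_le_of_foolingChain hT1 (by omega) A hne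
  -- `n ^ e ≤ 2 ^ (e * (log n + 1))`, and `e * (log n + 1) ≤ (log n) ^ 2 - 1`
  have h2 : n ^ e ≤ 2 ^ (logSq n - 1) := by
    calc n ^ e ≤ (2 ^ (Nat.log 2 n + 1)) ^ e :=
          Nat.pow_le_pow_left (Nat.lt_pow_succ_log_self one_lt_two n).le e
      _ = 2 ^ ((Nat.log 2 n + 1) * e) := by rw [pow_mul]
      _ ≤ 2 ^ (logSq n - 1) := by
        refine Nat.pow_le_pow_right (by norm_num) ?_
        obtain ⟨d, hd⟩ := Nat.exists_eq_add_of_le hL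
        rw [logSq, hd]
        refine Nat.le_sub_of_add_le ?_
        nlinarith [Nat.zero_le (d * e)]
  omega

end OracleSeparation

theorem theorem4p2 :
    (∃ R₁ : OracleSeparation.OracleRelation,
      OracleSeparation.InUniformCC Set.univ R₁ ∧
        ¬ OracleSeparation.InNC {α | OracleSeparation.StrictlyLipschitz α} R₁) ∧
    (∃ R₂ : OracleSeparation.OracleRelation,
      OracleSeparation.InUniformNC 3 Set.univ R₂ ∧
        ¬ OracleSeparation.InCC {α | OracleSeparation.StrictlyLipschitz α} R₂) :=
  ⟨⟨_, OracleSeparation.iterRelation_inUniformCC, OracleSeparation.iterRelation_notInNC⟩,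
    ⟨_, OracleSeparation.iterRelation_inUniformNC (by norm_num),
      OracleSeparation.iterRelation_notInCC⟩⟩
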